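/- Let $n,p\ge 1$ be integers. Let $\mathfrak{osp}(1|2n)$ be the complex Lie superalgebra generated by odd elements $B_1^{\pm},\dots,B_n^{\pm}$ subject to the relations $$[\{B_i^\xi,B_j^\eta\},B_l^\epsilon]=(\epsilon-\xi)\delta_{i,l}B_j^\eta+(\epsilon-\eta)\delta_{j,l}B_i^\xi,\qquad i,j,l\in\{1,\dots,n\},\ \xi,\eta,\epsilon\in\{+,-\}=\{\pm1\},$$ let $\mathfrak P=\operatorname{span}\{\{B_i^+,B_j^-\},\,B_i^-,\,\{B_i^-,B_j^-\}: 1\le i,j\le n\}$, let $\mathbb C|0\rangle$ be the one-dimensional $\mathfrak P$-module with $B_i^-|0\rangle=0$ and $\{B_i^+,B_j^-\}|0\rangle=p\,\delta_{i,j}|0\rangle$, and let $\overline V_n(p)=\operatorname{Ind}_{\mathfrak P}^{\mathfrak{osp}(1|2n)}\mathbb C|0\rangle$. Let $\mathcal{C}\ell_p$ be the complex Clifford algebra with generators $e_1,\dots,e_p$, $\{e_\alpha,e_\beta\}=2\delta_{\alpha,\beta}$, and let $\mathcal A=\mathbb C[x_{i,\alpha}:1\le i\le n,\ 1\le\alpha\le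 p]\otimes\mathcal{C}\ell_p$. Then $\mathcal A$ is an $\mathfrak{osp}(1|2n)$-module on which $B_i^+$ and $B_i^-$ act as the operators $X_i=\sum_{\alpha}x_{i,\alpha}e_\alpha$ and $D_i=\sum_\alpha\frac{\partial}{\partial x_{i,\alpha}}e_\alpha$ (with $e_\alpha$ acting by left multiplication), respectively. Let $L_n(p)\subset\mathcal A$ be the submodule generated by $1$. For $I=(i_1,\dots,i_k)$ with $1\le i_1<\dots<i_k\le n$ put $$B_I^+=\sum_{\sigma\in S_k}\operatorname{sgn}(\sigma)B^+_{i_{\sigma(1)}}\cdots B^+_{i_{\sigma(k)}},\qquad X_I=\sum_{\sigma\in S_k}\operatorname{sgn}(\sigma)X_{i_{\sigma(1)}}\cdots X_{i_{\sigma(k)}}.$$ For a semistandard Young tableau $A$ with entries in $\{1,\dots,n\}$ and with columns $a_1,\dots,a_m$ (from left to right, each read downwards) put $$v_A(p)=B^+_{a_m}\cdots B^+_{a_1}|0\rangle\in\overline V_n(p),\qquad \omega_A(p)=X_{a_m}\cdots X_{a_1}(1)\in L_n(p).$$ Then the family of the vectors $v_A(p)$, where $A$ runs through all semistandard Young tableaux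 with entries in $\{1,\dots,n\}$, is a basis of the complex vector space $\overline V_n(p)$, and the family of the vectors $\omega_A(p)$, where $A$ runs through those tableaux that have at most $p$ rows, is a basis of the complex vector space $L_n(p)$. -/

import Mathlib

open scoped TensorProduct

noncomputable section

namespace Paraboson

/-! ### Paraboson operators and the enveloping algebra of `osp(1|2n)`

Signs `ξ, η, ε ∈ {+, -}` are elements of `ℤˣ = {1, -1}`, and indices `1, …, n` are
represented by the elements of `Fin n`. -/

/-- The anticommutator `{a, b} = ab + ba`. -/
def anticomm {R : Type*} [Ring R] (a b : R) : R := a * b + b * a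

/-- Left-hand side `[{B_i^ξ, B_j^η}, B_l^ε]` of the triple relations. -/
def tripleLHS {n : ℕ} {R : Type*} [Ring R] (B : ℤˣ → Fin n → R)
    (ξ η ε : ℤˣ) (i j l : Fin n) : R :=
  anticomm (B ξ i) (B η j) * B ε l - B ε l * anticomm (B ξ i) (B η j)

/-- Right-hand side `(ε - ξ) δ_{il} B_j^η + (ε - η) δ_{jl} B_i^ξ` of the triple relations. -/
def tripleRHS {n : ℕ} {R : Type*} [Ring R] (B : ℤˣ → Fin n → R)
    (ξ η ε : ℤˣ) (i j l : Fin n) : R :=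
  (if i = l then (ε : ℤ) - (ξ : ℤ) else 0) • B η j +
    (if j = l then (ε : ℤ) - (η : ℤ) else 0) • B ξ i

/-- The triple relations imposed on the free generators `B_i^ξ`. -/
inductive TripleRel (n : ℕ) :
    FreeAlgebra ℂ (ℤˣ × Fin n) → FreeAlgebra ℂ (ℤˣ × Fin n) → Prop
  | triple (ξ η ε : ℤˣ) (i j l : Fin n) :
      TripleRel n
        (tripleLHS (fun s k => FreeAlgebra.ι ℂ (s, k)) ξ η ε i j l)
        (tripleRHS (fun s k => FreeAlgebra.ι ℂ (s, k)) ξ η ε i j l)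

/-- The universal enveloping algebra of the complex Lie superalgebra `osp(1|2n)`, the latter being
presented by the odd generators `B_i^±` and the triple relations.  As the superbracket of two odd
elements is the anticommutator and that of an even and an odd element is the commutator, the
enveloping algebra is the associative unital algebra with the same generators and relations;
an `osp(1|2n)`-module is a module over it. -/
abbrev UOsp (n : ℕ) : Type := RingQuot (TripleRel n)

/-- The generators `B_i^ξ` in the enveloping algebra. -/
def gen {n : ℕ} (ξ : ℤˣ) (i : Fin n) : UOsp n :=
  RingQuot.mkAlgHom ℂ (TripleRel n) (FreeAlgebra.ι ℂ (ξ, i))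

/-- `B_i^+`. -/
abbrev Bp {n : ℕ} (i : Fin n) : UOsp n := gen 1 i

/-- `B_i^-`. -/
abbrev Bm {n : ℕ} (i : Fin n) : UOsp n := gen (-1) i

/-! ### The induced module -/

/-- The elements `x - χ(x)`, where `x` runs through the spanning elements
`{B_i^+, B_j^-}`, `B_i^-`, `{B_i^-, B_j^-}` of the parabolic subalgebra `𝔓`, and `χ(x)` is the
scalar by which `x` acts on the one-dimensional `𝔓`-module `ℂ|0⟩`, namely
`χ({B_i^+, B_j^-}) = p δ_{ij}` and `χ(B_i^-) = χ({B_i^-, B_j^-}) = 0`. -/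
inductive IsVacuumRelator (n p : ℕ) : UOsp n → Prop
  | mixed (i j : Fin n) :
      IsVacuumRelator n p
        (anticomm (Bp i) (Bm j) - algebraMap ℂ (UOsp n) (if i = j then (p : ℂ) else 0))
  | lower (i : Fin n) : IsVacuumRelator n p (Bm i)
  | lower₂ (i j : Fin n) : IsVacuumRelator n p (anticomm (Bm i) (Bm j))

/-- The left ideal of the enveloping algebra generated by all `x - χ(x)`, `x ∈ 𝔓`. -/
def vacuumIdeal (n p : ℕ) : Submodule (UOsp n) (UOsp n) :=
  Submodule.span (UOsp n) {x | IsVacuumRelator n p x}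

/-- The induced module `V̄_n(p) = Ind_𝔓^{osp(1|2n)} ℂ|0⟩ = U(osp(1|2n)) ⊗_{U(𝔓)} ℂ|0⟩`.
As `ℂ|0⟩` is the one-dimensional module with character `χ`, this is the quotient of
`U(osp(1|2n))` by the left ideal generated by all `x - χ(x)`, `x ∈ 𝔓`. -/
abbrev InducedModule (n p : ℕ) : Type := UOsp n ⧸ vacuumIdeal n p

/-- The vector `|0⟩` of the induced module. -/
def vacuum (n p : ℕ) : InducedModule n p := Submodule.Quotient.mk (1 : UOsp n)

/-! ### Clifford algebra valued polynomials and the paraboson Fock space -/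

/-- The complex Clifford algebra with generators `e_1, …, e_p`, `{e_α, e_β} = 2 δ_{αβ}`. -/
abbrev Cl (p : ℕ) : Type :=
  CliffordAlgebra (QuadraticMap.weightedSumSquares ℂ (1 : Fin p → ℂ))

/-- The generators `e_α`. -/
def e {p : ℕ} (α : Fin p) : Cl p :=
  CliffordAlgebra.ι (QuadraticMap.weightedSumSquares ℂ (1 : Fin p → ℂ)) (Pi.single α 1)

/-- The space `𝒜` of Clifford algebra valued polynomials in the variables `x_{i,α}`. -/
abbrev CliffPoly (n p : ℕ) : Type := MvPolynomial (Fin n × Fin p) ℂ ⊗[ℂ] Cl p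

/-- The operator `X_i = ∑_α x_{i,α} e_α` on `𝒜`. -/
def X {n : ℕ} (p : ℕ) (i : Fin n) : Module.End ℂ (CliffPoly n p) :=
  ∑ α : Fin p, TensorProduct.map
    (LinearMap.mulLeft ℂ (MvPolynomial.X (i, α) : MvPolynomial (Fin n × Fin p) ℂ))
    (LinearMap.mulLeft ℂ (e α))

/-- The operator `D_i = ∑_α ∂_{i,α} e_α` on `𝒜`. -/
def D {n : ℕ} (p : ℕ) (i : Fin n) : Module.End ℂ (CliffPoly n p) :=
  ∑ α : Fin p, TensorProduct.map
    (MvPolynomial.pderiv (R := ℂ) (i, α)).toLinearMap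
    (LinearMap.mulLeft ℂ (e α))

/-- `B_i^+` acts on `𝒜` as `X_i`, and `B_i^-` acts as `D_i`. -/
def fockGen {n : ℕ} (p : ℕ) (ξ : ℤˣ) (i : Fin n) : Module.End ℂ (CliffPoly n p) :=
  if ξ = 1 then X p i else D p i

/-- The Clifford relations. -/
theorem e_anticomm {p : ℕ} (α β : Fin p) :
    e α * e β + e β * e α = algebraMap ℂ (Cl p) (if α = β then 2 else 0) := by
  unfold e
  rw [CliffordAlgebra.ι_mul_ι_add_swap]
  congr 1
  simp only [QuadraticMap.polar, QuadraticMap.weightedSumSquares_apply, Pi.add_apply,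
    Pi.one_apply, one_smul, Pi.single_apply]
  rw [← Finset.sum_sub_distrib, ← Finset.sum_sub_distrib]
  have h : ∀ x : Fin p,
      ((if x = α then (1 : ℂ) else 0) + (if x = β then 1 else 0)) *
        ((if x = α then (1 : ℂ) else 0) + (if x = β then 1 else 0)) -
        (if x = α then (1 : ℂ) else 0) * (if x = α then (1 : ℂ) else 0) -
        (if x = β then (1 : ℂ) else 0) * (if x = β then (1 : ℂ) else 0) =
      if x = α then (if α = β then 2 else 0) else 0 := by
    intro x
    split_ifs <;> simp_all; norm_num
  simp_rw [h]
  simp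

/-- The bosonic components: multiplication by `x_{i,α}` for `+`, and `∂_{i,α}` for `-`. -/
def bose {n p : ℕ} (ξ : ℤˣ) (i : Fin n) (α : Fin p) :
    Module.End ℂ (MvPolynomial (Fin n × Fin p) ℂ) :=
  if ξ = 1 then LinearMap.mulLeft ℂ (MvPolynomial.X (i, α))
  else (MvPolynomial.pderiv (R := ℂ) (i, α)).toLinearMap

theorem fockGen_eq {n : ℕ} (p : ℕ) (ξ : ℤˣ) (i : Fin n) :
    fockGen p ξ i =
      ∑ α : Fin p, TensorProduct.map (bose ξ i α) (LinearMap.mulLeft ℂ (e α)) := by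
  unfold fockGen bose X D
  split_ifs <;> rfl

/-- The canonical commutation relations. -/
theorem bose_comm {n p : ℕ} (ξ η : ℤˣ) (i j : Fin n) (α β : Fin p) :
    (2 : ℂ) • (bose ξ i α * bose η j β - bose η j β * bose ξ i α) =
      (if i = j ∧ α = β then (((η : ℤ) - (ξ : ℤ) : ℤ) : ℂ) else 0) •
        (1 : Module.End ℂ (MvPolynomial (Fin n × Fin p) ℂ)) := by
  apply LinearMap.ext
  intro f
  rcases Int.units_eq_one_or ξ with rfl | rfl <;> rcases Int.units_eq_one_or η with rfl | rfl
  · simp [bose, mul_left_comm]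
  · by_cases h : i = j ∧ α = β
    · obtain ⟨rfl, rfl⟩ := h
      simp [bose, Derivation.leibniz]
    · simp [bose, Derivation.leibniz, h, MvPolynomial.pderiv_X]
  · by_cases h : i = j ∧ α = β
    · obtain ⟨rfl, rfl⟩ := h
      simp [bose, Derivation.leibniz]
    · simp [bose, Derivation.leibniz, h, MvPolynomial.pderiv_X]
  · have h : ⁅MvPolynomial.pderiv (R := ℂ) (i, α), MvPolynomial.pderiv (R := ℂ) (j, β)⁆ = 0 := by
      apply MvPolynomial.derivation_ext
      intro k
      simp [Derivation.commutator_apply, MvPolynomial.pderiv_X, Pi.single_apply, apply_ite]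
    have h2 := DFunLike.congr_fun h f
    rw [Derivation.commutator_apply] at h2
    simpa [bose] using h2

/-- Green's ansatz: sums of products of bosonic and Clifford generators satisfy the
triple relations. -/
theorem green_ansatz {R : Type*} [Ring R] [Algebra ℂ R] {n p : ℕ}
    (q : ℤˣ → Fin n → Fin p → R) (E : Fin p → R)
    (hqE : ∀ ξ i α β, E β * q ξ i α = q ξ i α * E β)
    (hE : ∀ α β, E α * E β + E β * E α = algebraMap ℂ R (if α = β then 2 else 0))
    (hq : ∀ ξ η i j α β, (2 : ℂ) • (q ξ i α * q η j β - q η j β * q ξ i α) =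
      (if i = j ∧ α = β then (((η : ℤ) - (ξ : ℤ) : ℤ) : ℂ) else 0) • (1 : R))
    (ξ η ε : ℤˣ) (i j l : Fin n) :
    tripleLHS (fun s k => ∑ α, q s k α * E α) ξ η ε i j l =
      tripleRHS (fun s k => ∑ α, q s k α * E α) ξ η ε i j l := by
  have hE1 : ∀ α, E α * E α = 1 := by
    intro α
    have h := hE α α
    rw [if_pos rfl, ← two_smul ℂ, Algebra.algebraMap_eq_smul_one] at h
    exact smul_right_injective R (two_ne_zero' ℂ) h
  have hE0 : ∀ α β, α ≠ β → E β * E α = - (E α * E β) := by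
    intro α β h
    have h' := hE α β
    rw [if_neg h, map_zero] at h'
    exact (neg_eq_of_add_eq_zero_right h').symm
  have hq0 : ∀ ξ η i j α β, α ≠ β → q ξ i α * q η j β = q η j β * q ξ i α := by
    intro ξ η i j α β h
    have h' := hq ξ η i j α β
    rw [if_neg (fun h2 => h h2.2), zero_smul] at h'
    exact sub_eq_zero.1 ((smul_eq_zero.1 h').resolve_left two_ne_zero)
  have hanti : anticomm (∑ α, q ξ i α * E α) (∑ α, q η j α * E α) =
      ∑ α, (q ξ i α * q η j α + q η j α * q ξ i α) := by
    unfold anticomm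
    rw [Finset.sum_mul_sum, Finset.sum_mul_sum, Finset.sum_comm (s := Finset.univ)
      (t := Finset.univ) (f := fun a b => q η j a * E a * (q ξ i b * E b)),
      ← Finset.sum_add_distrib]
    refine Finset.sum_congr rfl fun α _ => ?_
    rw [← Finset.sum_add_distrib, Finset.sum_eq_single α]
    · have h1 : q ξ i α * E α * (q η j α * E α) = q ξ i α * q η j α * (E α * E α) := by
        rw [mul_assoc, ← mul_assoc (E α), hqE]; noncomm_ring
      have h2 : q η j α * E α * (q ξ i α * E α) = q η j α * q ξ i α * (E α * E α) := by
        rw [mul_assoc, ← mul_assoc (E α), hqE]; noncomm_ring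
      rw [h1, h2, hE1, mul_one, mul_one]
    · intro β _ hβ
      have h1 : q ξ i α * E α * (q η j β * E β) = q ξ i α * q η j β * (E α * E β) := by
        rw [mul_assoc, ← mul_assoc (E α), hqE]; noncomm_ring
      have h2 : q η j β * E β * (q ξ i α * E α) = q η j β * q ξ i α * (E β * E α) := by
        rw [mul_assoc, ← mul_assoc (E β), hqE]; noncomm_ring
      rw [h1, h2, hE0 α β hβ.symm, hq0 ξ η i j α β hβ.symm, mul_neg, add_neg_cancel]
    · simp
  have key : ∀ α β,
      (q ξ i α * q η j α + q η j α * q ξ i α) * (q ε l β * E β) -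
        (q ε l β * E β) * (q ξ i α * q η j α + q η j α * q ξ i α) =
      if α = β then ((if i = l then ((ε : ℤ) - (ξ : ℤ)) else 0) • (q η j α * E α) +
        (if j = l then ((ε : ℤ) - (η : ℤ)) else 0) • (q ξ i α * E α)) else 0 := by
    intro α β
    have e1 : (q ε l β * E β) * (q ξ i α * q η j α + q η j α * q ξ i α) =
        q ε l β * (q ξ i α * q η j α + q η j α * q ξ i α) * E β := by
      have : E β * (q ξ i α * q η j α + q η j α * q ξ i α) =
          (q ξ i α * q η j α + q η j α * q ξ i α) * E β := by
        rw [mul_add, ← mul_assoc, ← mul_assoc, hqE, hqE, mul_assoc, mul_assoc, hqE, hqE]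
        noncomm_ring
      rw [mul_assoc, this, mul_assoc]
    rw [e1]
    have c1 := hq ξ ε i l α β
    have c2 := hq η ε j l α β
    by_cases hαβ : α = β
    swap
    · rw [if_neg hαβ]
      have k1 := hq0 ξ ε i l α β hαβ
      have k2 := hq0 η ε j l α β hαβ
      have : (q ξ i α * q η j α + q η j α * q ξ i α) * q ε l β =
          q ε l β * (q ξ i α * q η j α + q η j α * q ξ i α) := by
        rw [add_mul, mul_assoc, k2, ← mul_assoc, k1, mul_assoc (q η j α), k1, ← mul_assoc (q η j α),
          k2]
        noncomm_ring
      rw [← mul_assoc, this, sub_self]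
    · subst hαβ
      rw [if_pos rfl]
      set a := q ξ i α
      set b := q η j α
      set c := q ε l α
      have expand : (a * b + b * a) * (c * E α) - c * (a * b + b * a) * E α =
          (((a * c - c * a) * b + b * (a * c - c * a)) +
            (a * (b * c - c * b) + (b * c - c * b) * a)) * E α := by
        noncomm_ring
      have half : ∀ x : R, ∀ z : ℂ, (2 : ℂ) • x = z • (1 : R) → x = (z / 2) • (1 : R) := by
        intro x z h
        rw [div_eq_inv_mul, mul_smul, ← h, smul_smul, inv_mul_cancel₀ two_ne_zero, one_smul]
      rw [expand, half _ _ c1, half _ _ c2]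
      simp only [and_true, smul_mul_assoc, one_mul, mul_smul_comm, mul_one, ← add_smul, add_halves,
        add_mul]
      split_ifs <;> simp [← Int.cast_smul_eq_zsmul ℂ]
  unfold tripleLHS tripleRHS
  simp only [hanti]
  rw [Finset.sum_mul_sum, Finset.sum_mul_sum, Finset.sum_comm (s := Finset.univ)
      (t := Finset.univ) (f := fun a b => q ε l a * E a * (q ξ i b * q η j b + q η j b * q ξ i b)),
      ← Finset.sum_sub_distrib]
  simp only [← Finset.sum_sub_distrib, key]
  simp [Finset.sum_add_distrib, Finset.smul_sum]

/-- The operators `X_i`, `D_i` satisfy the triple relations. -/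
theorem fockGen_triple {n : ℕ} (p : ℕ) (ξ η ε : ℤˣ) (i j l : Fin n) :
    tripleLHS (fockGen (n := n) p) ξ η ε i j l = tripleRHS (fockGen (n := n) p) ξ η ε i j l := by
  have h : (fockGen (n := n) p) = fun s k => ∑ α : Fin p,
      TensorProduct.map (bose s k α) (1 : Module.End ℂ (Cl p)) *
        TensorProduct.map (1 : Module.End ℂ (MvPolynomial (Fin n × Fin p) ℂ))
          (LinearMap.mulLeft ℂ (e α)) := by
    funext s k
    rw [fockGen_eq]
    refine Finset.sum_congr rfl fun α _ => ?_
    rw [← TensorProduct.map_mul, mul_one, one_mul]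
  rw [h]
  apply green_ansatz
  · intro ξ i α β
    rw [← TensorProduct.map_mul, ← TensorProduct.map_mul]
    simp
  · intro α β
    rw [← TensorProduct.map_mul, ← TensorProduct.map_mul, one_mul, ← TensorProduct.map_add_right]
    have : LinearMap.mulLeft ℂ (e α) * LinearMap.mulLeft ℂ (e β) +
        LinearMap.mulLeft ℂ (e β) * LinearMap.mulLeft ℂ (e α) =
        (if α = β then (2 : ℂ) else 0) • (1 : Module.End ℂ (Cl p)) := by
      apply LinearMap.ext
      intro x
      have := congrArg (fun y => y * x) (e_anticomm α β)
      simp only [add_mul, mul_assoc, Algebra.algebraMap_eq_smul_one, smul_mul_assoc, one_mul]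
        at this
      rw [LinearMap.smul_apply]
      simpa using this
    rw [this, TensorProduct.map_smul_right, TensorProduct.map_one, Algebra.algebraMap_eq_smul_one]
  · intro ξ η i j α β
    rw [← TensorProduct.map_mul, ← TensorProduct.map_mul, one_mul]
    change (2 : ℂ) • (LinearMap.rTensor (Cl p) _ - LinearMap.rTensor (Cl p) _) = _
    rw [← LinearMap.rTensor_sub, ← LinearMap.rTensor_smul, bose_comm, LinearMap.rTensor_smul]
    congr 1
    exact TensorProduct.map_one

/-- The action of (the enveloping algebra of) `osp(1|2n)` on `𝒜`, with `B_i^+ ↦ X_i` and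
`B_i^- ↦ D_i`. -/
def fockRep (n p : ℕ) : UOsp n →ₐ[ℂ] Module.End ℂ (CliffPoly n p) :=
  RingQuot.liftAlgHom ℂ
    ⟨FreeAlgebra.lift ℂ (fun g : ℤˣ × Fin n => fockGen p g.1 g.2), by
      rintro _ _ ⟨ξ, η, ε, i, j, l⟩
      have h := fockGen_triple p ξ η ε i j l
      simp only [tripleLHS, tripleRHS, anticomm] at h ⊢
      simpa only [map_sub, map_add, map_mul, map_zsmul, FreeAlgebra.lift_ι_apply] using h⟩

/-- The generator `B_i^+` acts as `X_i`. -/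
theorem fockRep_Bp {n : ℕ} (p : ℕ) (i : Fin n) : fockRep n p (Bp i) = X p i := by
  simp [fockRep, gen, fockGen]

/-- The generator `B_i^-` acts as `D_i`. -/
theorem fockRep_Bm {n : ℕ} (p : ℕ) (i : Fin n) : fockRep n p (Bm i) = D p i := by
  have h : (-1 : ℤˣ) ≠ 1 := by decide
  simp [fockRep, gen, fockGen, h]

/-- The paraboson Fock space `L_n(p)`: the submodule of `𝒜` generated by the action of
`osp(1|2n)` on `1 ∈ 𝒜`, that is, the space of all `u · 1` with `u` in the enveloping algebra. -/
def fockSpace (n p : ℕ) : Submodule ℂ (CliffPoly n p) :=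
  LinearMap.range
    ((LinearMap.applyₗ (1 : CliffPoly n p)) ∘ₗ (fockRep n p).toLinearMap)

/-! ### Tableau vectors -/

/-- A semistandard Young tableau with entries in `{1, …, n}`.  The entries are shifted by one, to
`{0, …, n - 1}`, in accordance with the index set `Fin n` of the generators. -/
structure Tableau (n : ℕ) where
  /-- The shape. -/
  shape : YoungDiagram
  /-- The semistandard filling. -/
  filling : SemistandardYoungTableau shape
  /-- The bound on the entries. -/
  entry_lt : ∀ {k l : ℕ}, (k, l) ∈ shape → filling k l < n

/-- Number of rows of a tableau. -/
def Tableau.numRows {n : ℕ} (A : Tableau n) : ℕ := A.shape.colLen 0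

/-- Number of columns of a tableau. -/
def Tableau.numCols {n : ℕ} (A : Tableau n) : ℕ := A.shape.rowLen 0

/-- The `l`-th column of a tableau (from left to right, starting at `0`), read downwards. -/
def Tableau.col {n : ℕ} (A : Tableau n) (l : ℕ) : Fin (A.shape.colLen l) → Fin n :=
  fun k => ⟨A.filling k l, A.entry_lt (YoungDiagram.mem_iff_lt_colLen.2 k.2)⟩

/-- `b_I = ∑_{σ ∈ S_k} sgn(σ) b_{i_{σ(1)}} ⋯ b_{i_{σ(k)}}` for `I = (i_1, …, i_k)`. -/
def columnOp {n k : ℕ} {R : Type*} [Ring R] (b : Fin n → R) (I : Fin k → Fin n) : R :=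
  ∑ σ : Equiv.Perm (Fin k),
    ((Equiv.Perm.sign σ : ℤˣ) : ℤ) • (List.ofFn fun r : Fin k => b (I (σ r))).prod

/-- `b_{a_m} ⋯ b_{a_1}`, where `a_1, …, a_m` are the columns of `A` from left to right. -/
def tableauOp {n : ℕ} {R : Type*} [Ring R] (b : Fin n → R) (A : Tableau n) : R :=
  (List.ofFn fun l : Fin A.numCols => columnOp b (A.col l)).reverse.prod

/-- The tableau vector `v_A(p) = B^+_{a_m} ⋯ B^+_{a_1} |0⟩` of the induced module. -/
def v {n : ℕ} (p : ℕ) (A : Tableau n) : InducedModule n p :=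
  tableauOp Bp A • vacuum n p

/-- The tableau vector `ω_A(p) = X_{a_m} ⋯ X_{a_1} (1)`, a Clifford algebra valued polynomial. -/
def ω {n : ℕ} (p : ℕ) (A : Tableau n) : CliffPoly n p :=
  tableauOp (X p) A 1

end Paraboson

end

open scoped TensorProduct

noncomputable section

namespace Paraboson

/-! ### Antisymmetrized products. -/

section ColumnOp

/-! Both modules are controlled by the algebra `ParaAlg n` generated by `b_1, …, b_n` with the sole
relations `[{b_i, b_j}, b_k] = 0`, which the creation operators satisfy. The tableau elements span
this algebra by a straightening argument, and they are independent because their images in `𝒜` have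
distinct leading monomials.

Straightening (`span_tableauOp_eq_top`). Tensoring with a Grassmann algebra, put `Y_a = b_{f(a)} ⊗
η_a`. The sign of the Grassmann variables turns anticommutators into commutators, so the `Y_a` have
square zero and central commutators, and a column operator becomes a power of a sum of `Y_a`. In
this Heisenberg-like setting, transferring a label from one power to the other, in either direction,
produces the same correction term. Eliminating it (`exchange_mem`) and iterating gives Garnir
relations modulo products with a longer right factor (`garnir`). As the right factor is the left
column, two adjacent columns that violate semistandardness become a combination of pairs whose left
column is longer, or equally long with smaller entry sum (`columnSet_mul_columnSet_mem`). This
descent terminates.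

The induced module. Moving annihilation operators to the right shows that `ParaAlg n` maps onto it.
Injectivity, usually a consequence of Poincaré–Birkhoff–Witt, follows from an explicit action of
`osp(1|2n)` on `ParaAlg n` in which `1` is a vacuum vector (`exists_action`).

Independence (`linearIndependent_ω`). In a column operator of length `k ≤ p`, the lexicographically
leading monomial is `∏_r x_{i_r, r}`, with an invertible Clifford coefficient. Thus the leading
monomial of `ω_A` records how often each entry occurs in each row, which determines `A`. For `p = n`
every tableau is admissible, which gives independence in `ParaAlg n`, hence in the induced module
for every `p`. In `L_n(p)` the columns longer than `p` act by zero by the pigeonhole principle, so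
the remaining `ω_A` span. -/

theorem map_columnOp {n k : ℕ} {R S : Type*} [Ring R] [Ring S] (f : R →+* S) (b : Fin n → R)
    (I : Fin k → Fin n) : f (columnOp b I) = columnOp (fun i => f (b i)) I := by
  simp only [columnOp, map_sum, map_zsmul, map_list_prod, List.map_ofFn]
  rfl

theorem columnOp_comp_perm {n k : ℕ} {R : Type*} [Ring R] (b : Fin n → R) (I : Fin k → Fin n)
    (τ : Equiv.Perm (Fin k)) :
    columnOp b (I ∘ τ) = ((Equiv.Perm.sign τ : ℤˣ) : ℤ) • columnOp b I := by
  unfold columnOp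
  rw [Finset.smul_sum]
  refine Fintype.sum_equiv (Equiv.mulLeft τ) _ _ fun σ => ?_
  simp only [Equiv.coe_mulLeft, Function.comp_apply, Equiv.Perm.coe_mul, Equiv.Perm.sign_mul,
    Units.val_mul, smul_smul]
  rw [← mul_assoc, ← Units.val_mul, Int.units_mul_self]
  simp

/-- Transposing two equal entries changes nothing but reverses the sign, so twice the operator
vanishes. -/
theorem columnOp_eq_zero {n k : ℕ} {R : Type*} [Ring R] [Algebra ℂ R] (b : Fin n → R)
    {I : Fin k → Fin n} (hI : ¬ Function.Injective I) : columnOp b I = 0 := by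
  simp only [Function.Injective, not_forall] at hI
  obtain ⟨r, s, h, hrs⟩ := hI
  have h1 : I ∘ Equiv.swap r s = I := by
    funext t
    rw [Function.comp_apply, Equiv.swap_apply_def]
    split_ifs with h1 h2 <;> simp_all
  have h2 := columnOp_comp_perm b I (Equiv.swap r s)
  rw [h1, Equiv.Perm.sign_swap hrs] at h2
  have h3 : (2 : ℂ) • columnOp b I = 0 := by
    rw [two_smul]
    nth_rewrite 1 [h2]
    simp
  exact (smul_eq_zero.1 h3).resolve_left two_ne_zero

theorem columnOp_congr {n k k' : ℕ} {R : Type*} [Ring R] (b : Fin n → R) (h : k = k')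
    {I : Fin k → Fin n} {I' : Fin k' → Fin n} (hI : ∀ r, I r = I' (Fin.cast h r)) :
    columnOp b I = columnOp b I' := by
  subst h
  congr 1
  exact funext hI

/-- The column operator of a set of indices. -/
def columnSet {n : ℕ} {R : Type*} [Ring R] (b : Fin n → R) (S : Finset (Fin n)) : R :=
  columnOp b (S.orderEmbOfFin rfl)

theorem columnSet_empty {n : ℕ} {R : Type*} [Ring R] (b : Fin n → R) : columnSet b ∅ = 1 := by
  have h : columnSet b ∅ = columnOp b (Fin.elim0 : Fin 0 → Fin n) :=
    columnOp_congr b Finset.card_empty fun r => (Fin.cast Finset.card_empty r).elim0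
  rw [h]
  simp [columnOp]

theorem columnOp_eq_columnSet {n k : ℕ} {R : Type*} [Ring R] (b : Fin n → R)
    {I : Fin k → Fin n} (hI : Function.Injective I) :
    ∃ u : ℤˣ, columnOp b I = (u : ℤ) • columnSet b (Finset.univ.image I) := by
  have hc : (Finset.univ.image I).card = k := by
    rw [Finset.card_image_of_injective _ hI, Finset.card_univ, Fintype.card_fin]
  have hmem : ∀ r, I r ∈ Finset.univ.image I := fun r => Finset.mem_image_of_mem _ (Finset.mem_univ r)
  let f : Fin k → Fin k := fun r => ((Finset.univ.image I).orderIsoOfFin hc).symm ⟨I r, hmem r⟩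
  have hf : Function.Injective f := by
    intro r s h
    have := (OrderIso.injective _) h
    exact hI (congrArg Subtype.val this)
  let τ : Equiv.Perm (Fin k) := Equiv.ofBijective f (Finite.injective_iff_bijective.1 hf)
  have hτ : I = ((Finset.univ.image I).orderEmbOfFin hc) ∘ τ := by
    funext r
    simp [τ, f, ← Finset.coe_orderIsoOfFin_apply]
  refine ⟨Equiv.Perm.sign τ, ?_⟩
  conv_lhs => rw [hτ]
  rw [columnOp_comp_perm]
  congr 1
  unfold columnSet
  refine columnOp_congr b hc.symm fun r => ?_
  rw [← Finset.coe_orderIsoOfFin_apply, ← Finset.coe_orderIsoOfFin_apply]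
  simp [Finset.orderIsoOfFin, Fin.cast]

theorem list_prod_ofFn_sum {R ι : Type*} [Ring R] [Algebra ℂ R] [Fintype ι] {k : ℕ}
    (f : Fin k → ι → R) :
    (List.ofFn fun r => ∑ a, f r a).prod = ∑ w : Fin k → ι, (List.ofFn fun r => f r (w r)).prod := by
  classical
  have := (MultilinearMap.mkPiAlgebraFin ℂ k R).map_sum f
  simpa [MultilinearMap.mkPiAlgebraFin_apply] using this

theorem list_prod_ofFn_tmul {R S : Type*} [Ring R] [Algebra ℂ R] [Ring S] [Algebra ℂ S] {k : ℕ}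
    (f : Fin k → R) (g : Fin k → S) :
    (List.ofFn fun r => f r ⊗ₜ[ℂ] g r).prod = (List.ofFn f).prod ⊗ₜ[ℂ] (List.ofFn g).prod := by
  induction k with
  | zero => simp [Algebra.TensorProduct.one_def]
  | succ k ih =>
    simp only [List.ofFn_succ, List.prod_cons]
    rw [ih]
    simp

theorem sum_fun_eq_sum_perm {M : Type*} [AddCommMonoid M] {k : ℕ} (F : (Fin k → Fin k) → M)
    (hF : ∀ w, ¬ Function.Injective w → F w = 0) :
    ∑ w, F w = ∑ σ : Equiv.Perm (Fin k), F σ := by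
  classical
  rw [← Finset.sum_filter_of_ne (s := Finset.univ) (p := fun w => Function.Injective w)]
  · refine (Finset.sum_bij (fun (σ : Equiv.Perm (Fin k)) _ => (σ : Fin k → Fin k)) ?_ ?_ ?_ ?_).symm
    · intro σ _
      simpa using σ.injective
    · intro σ _ τ _ h
      exact DFunLike.coe_injective h
    · intro w hw
      simp only [Finset.mem_filter, Finset.mem_univ, true_and] at hw
      exact ⟨Equiv.ofBijective w (Finite.injective_iff_bijective.1 hw), Finset.mem_univ _, rfl⟩
    · intro σ _
      rfl
  · intro w _ hw
    by_contra h
    exact hw (hF w h)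

end ColumnOp

/-- Double counting: a set of size `j + 1` arises once for each of its elements, taken as the one
inserted last. -/
theorem sum_powersetCard_insert {T M : Type*} [DecidableEq T] [AddCommMonoid M] (K : Finset T) (j : ℕ)
    (f : Finset T → M) :
    ∑ L ∈ K.powersetCard j, ∑ a ∈ K \ L, f (insert a L) =
      ∑ L ∈ K.powersetCard (j + 1), (j + 1) • f L := by
  have h1 : ∀ L ∈ K.powersetCard (j + 1), (j + 1) • f L = ∑ a ∈ L, f L := by
    intro L hL
    rw [Finset.sum_const, (Finset.mem_powersetCard.1 hL).2]
  rw [Finset.sum_congr rfl h1, Finset.sum_sigma', Finset.sum_sigma']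
  refine Finset.sum_bij' (fun x _ => ⟨insert x.2 x.1, x.2⟩) (fun x _ => ⟨x.1.erase x.2, x.2⟩)
    ?_ ?_ ?_ ?_ ?_
  · rintro ⟨L, a⟩ hx
    simp only [Finset.mem_sigma, Finset.mem_powersetCard, Finset.mem_sdiff] at hx ⊢
    refine ⟨⟨Finset.insert_subset hx.2.1 hx.1.1, ?_⟩, Finset.mem_insert_self _ _⟩
    rw [Finset.card_insert_of_notMem hx.2.2, hx.1.2]
  · rintro ⟨L, a⟩ hx
    simp only [Finset.mem_sigma, Finset.mem_powersetCard, Finset.mem_sdiff] at hx ⊢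
    refine ⟨⟨(Finset.erase_subset _ _).trans hx.1.1, ?_⟩, hx.1.1 hx.2, Finset.notMem_erase _ _⟩
    rw [Finset.card_erase_of_mem hx.2, hx.1.2, Nat.add_sub_cancel]
  · rintro ⟨L, a⟩ hx
    simp only [Finset.mem_sigma, Finset.mem_sdiff] at hx
    simp [Finset.erase_insert hx.2.2]
  · rintro ⟨L, a⟩ hx
    simp only [Finset.mem_sigma] at hx
    simp [Finset.insert_erase hx.2]
  · rintro ⟨L, a⟩ _
    rfl

/-! ### Exchange and Garnir relations for square-zero elements with central commutators. -/

section NilpotentHeisenberg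

variable {R : Type*} [Ring R]

theorem pow_mul_of_central [Algebra ℂ R] {P y c : R} (hc : c = P * y - y * P) (hcP : Commute c P) (m : ℕ) :
    P ^ m * y = y * P ^ m + (m : ℂ) • (c * P ^ (m - 1)) := by
  induction m with
  | zero => simp
  | succ m ih =>
    have h1 : P * y = y * P + c := by rw [hc]; abel
    have h2 : (m : ℂ) • (c * P ^ (m - 1) * P) = (m : ℂ) • (c * P ^ m) := by
      rcases m with _ | m
      · simp
      · rw [mul_assoc, ← pow_succ]; rfl
    have h3 : P ^ m * c = c * P ^ m := (hcP.pow_right m).eq.symm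
    calc P ^ (m + 1) * y = P ^ m * y * P + P ^ m * c := by rw [pow_succ, mul_assoc, h1]; noncomm_ring
      _ = y * P ^ m * P + (m : ℂ) • (c * P ^ (m - 1) * P) + c * P ^ m := by
        rw [ih, h3, add_mul, smul_mul_assoc]
      _ = _ := by
        rw [h2, mul_assoc, ← pow_succ, Nat.add_sub_cancel]
        push_cast
        module

/-- Words with two letters `y` vanish, since `y P^k y` reduces to multiples of `y * y` and `c * y`.
In the words with one `y`, moving it to the right past `P^k` costs `k c P^(k-1)`, and these costs
add up to the coefficient `m(m+1)/2`. The truncated exponent `m - 1` is harmless because its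
coefficient vanishes at `m = 0`. -/
theorem add_pow_of_central [Algebra ℂ R] {P y c : R} (hc : c = P * y - y * P) (hcP : Commute c P)
    (hcy : c * y = 0) (hyy : y * y = 0) (m : ℕ) :
    (P + y) ^ (m + 1) = P ^ (m + 1) + ((m : ℂ) + 1) • (P ^ m * y) -
      (((m : ℂ) + 1) * m / 2) • (c * P ^ (m - 1)) := by
  induction m with
  | zero => simp
  | succ m ih =>
    have h1 : y * P = P * y - c := by rw [hc]; abel
    have h2 : ∃ z : R, z = c * P ^ (m - 1) ∧ (m : ℂ) • (z * P) = (m : ℂ) • (c * P ^ m) := by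
      refine ⟨_, rfl, ?_⟩
      rcases m with _ | m
      · simp
      · rw [mul_assoc, ← pow_succ]; rfl
    obtain ⟨z, hz, h2⟩ := h2
    have h3 : P ^ m * c = c * P ^ m := (hcP.pow_right m).eq.symm
    have h4 : c * P ^ (m - 1) * y = 0 := by
      rw [(hcP.pow_right _).eq, mul_assoc, hcy, mul_zero]
    rw [← hz] at h4 ih
    have h5 : (((m : ℂ) + 1) * m / 2) • (z * P) = (((m : ℂ) + 1) * m / 2) • (c * P ^ m) := by
      rw [mul_div_right_comm, mul_smul, h2, smul_smul]
    have h6 : P ^ m * y * P = P ^ (m + 1) * y - c * P ^ m := by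
      rw [mul_assoc, h1, mul_sub, h3, ← mul_assoc, ← pow_succ]
    rw [pow_succ, ih, sub_mul, add_mul, mul_add, mul_add, smul_mul_assoc, smul_mul_assoc,
      smul_mul_assoc, mul_add z,
      h4, add_zero, h5, ← pow_succ, h6, mul_assoc _ y y, hyy, mul_zero, Nat.add_sub_cancel]
    push_cast
    module

theorem mul_add_pow_of_mul_eq_zero {P y d : R} (hdP : Commute d P) (hdy : d * y = 0) (m : ℕ) :
    d * (P + y) ^ m = d * P ^ m := by
  induction m with
  | zero => simp
  | succ m ih =>
    rw [pow_succ, ← mul_assoc, ih, mul_add, mul_assoc, ← pow_succ, (hdP.pow_right m).eq, mul_assoc,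
      hdy, mul_zero, add_zero]

theorem mul_pow_mul_eq_zero [Algebra ℂ R] {P y c : R} (hc : c = P * y - y * P) (hcP : Commute c P)
    (hcy : c * y = 0) (hyy : y * y = 0) (m : ℕ) : y * P ^ m * y = 0 := by
  have h := pow_mul_of_central hc hcP m
  have h4 : c * P ^ (m - 1) * y = 0 := by
    rw [(hcP.pow_right _).eq, mul_assoc, hcy, mul_zero]
  rw [← sub_eq_iff_eq_add] at h
  rw [← h, sub_mul, mul_assoc, hyy, smul_mul_assoc, h4, mul_zero, smul_zero, sub_zero]

theorem mul_add_pow [Algebra ℂ R] {P y c : R} (hc : c = P * y - y * P) (hcP : Commute c P)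
    (hcy : c * y = 0) (hyy : y * y = 0) (m : ℕ) : y * (P + y) ^ m = y * P ^ m := by
  induction m with
  | zero => simp
  | succ m ih =>
    rw [pow_succ, ← mul_assoc, ih, mul_add, mul_pow_mul_eq_zero hc hcP hcy hyy, add_zero, mul_assoc,
      ← pow_succ]

theorem add_pow_mul [Algebra ℂ R] {P y c : R} (hc : c = P * y - y * P) (hcP : Commute c P)
    (hcy : c * y = 0) (hyy : y * y = 0) (m : ℕ) : (P + y) ^ m * y = P ^ m * y := by
  induction m with
  | zero => simp
  | succ m ih =>
    rw [pow_succ', mul_assoc, ih, add_mul, ← mul_assoc, ← mul_assoc,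
      mul_pow_mul_eq_zero hc hcP hcy hyy, add_zero, ← pow_succ']

/-- Square-zero elements with central commutators. -/
structure NilHeisenberg {T : Type*} (Y : T → R) : Prop where
  comm : ∀ a b c, Commute (Y a * Y b - Y b * Y a) (Y c)
  sq : ∀ a, Y a * Y a = 0
  comm_mul : ∀ a b, (Y a * Y b - Y b * Y a) * Y b = 0

namespace NilHeisenberg

variable {T : Type*} {Y : T → R}

theorem sum_comm (Y : T → R) (S : Finset T) (a : T) :
    (∑ b ∈ S, Y b) * Y a - Y a * (∑ b ∈ S, Y b) = ∑ b ∈ S, (Y b * Y a - Y a * Y b) := by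
  rw [Finset.sum_mul, Finset.mul_sum, ← Finset.sum_sub_distrib]

theorem commute_sum (h : NilHeisenberg Y) (S : Finset T) (a b : T) :
    Commute (Y a * Y b - Y b * Y a) (∑ c ∈ S, Y c) :=
  Commute.sum_right _ _ _ fun c _ => h.comm a b c

theorem sum_commute_sum (h : NilHeisenberg Y) (S S' : Finset T) (a : T) :
    Commute ((∑ b ∈ S, Y b) * Y a - Y a * (∑ b ∈ S, Y b)) (∑ c ∈ S', Y c) := by
  rw [sum_comm]
  exact Commute.sum_left _ _ _ fun b _ => h.commute_sum _ _ _

theorem sum_comm_mul (h : NilHeisenberg Y) (S : Finset T) (a : T) :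
    ((∑ b ∈ S, Y b) * Y a - Y a * (∑ b ∈ S, Y b)) * Y a = 0 := by
  rw [sum_comm, Finset.sum_mul]
  exact Finset.sum_eq_zero fun b _ => h.comm_mul b a

variable [Algebra ℂ R] [DecidableEq T]

theorem sum_pow_card_succ (h : NilHeisenberg Y) (S : Finset T) :
    (∑ b ∈ S, Y b) ^ (S.card + 1) = 0 := by
  induction S using Finset.induction_on with
  | empty => simp
  | insert a S ha ih =>
    have hc := h.sum_commute_sum S S a
    have h0 := h.sum_comm_mul S a
    rw [Finset.card_insert_of_notMem ha, Finset.sum_insert ha, add_comm (Y a),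
      add_pow_of_central rfl hc h0 (h.sq a), pow_succ _ (S.card + 1), ih]
    -- Commuting the vanishing power `P^(|S|+1)` with `Y a` gives `c P^|S| = 0`, which disposes of
    -- the correction term.
    have h1 := pow_mul_of_central (y := Y a) rfl hc (S.card + 1)
    rw [ih, zero_mul, mul_zero, zero_add, eq_comm, smul_eq_zero] at h1
    have h2 := h1.resolve_left (Nat.cast_ne_zero.2 (Nat.succ_ne_zero S.card))
    rw [Nat.add_sub_cancel] at h2
    rw [Nat.add_sub_cancel, h2]
    simp

/-- The symmetrized product over a set of labels. -/
def symProd (Y : T → R) (S : Finset T) : R := (∑ b ∈ S, Y b) ^ S.card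

theorem symProd_insert (h : NilHeisenberg Y) {S : Finset T} {a : T} (ha : a ∉ S) :
    symProd Y (insert a S) = ((S.card : ℂ) + 1) • ((∑ b ∈ S, Y b) ^ S.card * Y a) -
      (((S.card : ℂ) + 1) * S.card / 2) •
        (((∑ b ∈ S, Y b) * Y a - Y a * (∑ b ∈ S, Y b)) * (∑ b ∈ S, Y b) ^ (S.card - 1)) := by
  rw [symProd, Finset.card_insert_of_notMem ha, Finset.sum_insert ha, add_comm (Y a),
      add_pow_of_central rfl (h.sum_commute_sum S S a) (h.sum_comm_mul S a) (h.sq a),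
      h.sum_pow_card_succ, zero_add]

theorem symProd_insert' (h : NilHeisenberg Y) {S : Finset T} {a : T} (ha : a ∉ S) :
    symProd Y (insert a S) = ((S.card : ℂ) + 1) • (Y a * (∑ b ∈ S, Y b) ^ S.card) +
      (((S.card : ℂ) + 1) * S.card / 2) •
        (((∑ b ∈ S, Y b) * Y a - Y a * (∑ b ∈ S, Y b)) * (∑ b ∈ S, Y b) ^ (S.card - 1)) := by
  rw [h.symProd_insert ha, pow_mul_of_central (y := Y a) rfl (h.sum_commute_sum S S a)]
  module

/-- After multiplication by `Y a` or by `[P, Y a]`, the power of the sum over `I.erase a` may be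
replaced by the power of the full sum `Q`, as both factors annihilate the extra terms. The sum over
`a` then only sees `∑ Y a = Q`. -/
theorem exchange_left (h : NilHeisenberg Y) {J I : Finset T} (hJI : Disjoint J I)
    (hI : I.Nonempty) :
    ∑ a ∈ I, symProd Y (insert a J) * symProd Y (I.erase a) =
      ((J.card : ℂ) + 1) • (symProd Y J * symProd Y I) -
      (((J.card : ℂ) + 1) * J.card / 2) •
        (((∑ b ∈ J, Y b) * (∑ b ∈ I, Y b) - (∑ b ∈ I, Y b) * (∑ b ∈ J, Y b)) *
          ((∑ b ∈ J, Y b) ^ (J.card - 1) * (∑ b ∈ I, Y b) ^ (I.card - 1))) := by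
  set P := ∑ b ∈ J, Y b with hP
  set Q := ∑ b ∈ I, Y b with hQ
  have key : ∀ a ∈ I, symProd Y (insert a J) * symProd Y (I.erase a) =
      ((J.card : ℂ) + 1) • (P ^ J.card * (Y a * Q ^ (I.card - 1))) -
      (((J.card : ℂ) + 1) * J.card / 2) •
        ((P * Y a - Y a * P) * (P ^ (J.card - 1) * Q ^ (I.card - 1))) := by
    intro a ha
    have hQ' : Q = (∑ b ∈ I.erase a, Y b) + Y a := (Finset.sum_erase_add I Y ha).symm
    have e1 : Y a * Q ^ (I.card - 1) = Y a * (∑ b ∈ I.erase a, Y b) ^ (I.card - 1) := by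
      rw [hQ']
      exact mul_add_pow rfl (h.sum_commute_sum _ _ a) (h.sum_comm_mul _ a) (h.sq a) _
    have e2 : (P * Y a - Y a * P) * Q ^ (I.card - 1) =
        (P * Y a - Y a * P) * (∑ b ∈ I.erase a, Y b) ^ (I.card - 1) := by
      rw [hQ']
      exact mul_add_pow_of_mul_eq_zero (h.sum_commute_sum _ _ a) (h.sum_comm_mul _ a) _
    have e3 : Commute (P * Y a - Y a * P) (P ^ (J.card - 1)) :=
      (h.sum_commute_sum J J a).pow_right _
    rw [h.symProd_insert (Finset.disjoint_right.1 hJI ha), symProd, Finset.card_erase_of_mem ha, e1,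
      ← mul_assoc (P * Y a - Y a * P), e3.eq, mul_assoc, e2, sub_mul, smul_mul_assoc, smul_mul_assoc,
      mul_assoc, ← hP, mul_assoc (P ^ (J.card - 1))]
  rw [Finset.sum_congr rfl key, Finset.sum_sub_distrib, ← Finset.smul_sum, ← Finset.smul_sum,
    ← Finset.mul_sum, ← Finset.sum_mul, ← Finset.sum_mul, Finset.sum_sub_distrib, ← Finset.mul_sum,
    ← Finset.sum_mul, ← hQ]
  rw [← pow_succ', Nat.sub_add_cancel hI.card_pos]
  rfl

/-- The mirror image of `exchange_left`. The point is that the correction term `[P, Q] P^(|J|-1)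
Q^(|I|-1)` is the same, so that it can be eliminated between the two. -/
theorem exchange_right (h : NilHeisenberg Y) {J I : Finset T} (hJI : Disjoint J I)
    (hJ : J.Nonempty) :
    ∑ a ∈ J, symProd Y (J.erase a) * symProd Y (insert a I) =
      ((I.card : ℂ) + 1) • (symProd Y J * symProd Y I) -
      (((I.card : ℂ) + 1) * I.card / 2) •
        (((∑ b ∈ J, Y b) * (∑ b ∈ I, Y b) - (∑ b ∈ I, Y b) * (∑ b ∈ J, Y b)) *
          ((∑ b ∈ J, Y b) ^ (J.card - 1) * (∑ b ∈ I, Y b) ^ (I.card - 1))) := by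
  set P := ∑ b ∈ J, Y b with hP
  set Q := ∑ b ∈ I, Y b with hQ
  have key : ∀ a ∈ J, symProd Y (J.erase a) * symProd Y (insert a I) =
      ((I.card : ℂ) + 1) • (P ^ (J.card - 1) * Y a * Q ^ I.card) +
      (((I.card : ℂ) + 1) * I.card / 2) •
        ((Q * Y a - Y a * Q) * (P ^ (J.card - 1) * Q ^ (I.card - 1))) := by
    intro a ha
    have hP' : P = (∑ b ∈ J.erase a, Y b) + Y a := (Finset.sum_erase_add J Y ha).symm
    have e1 : P ^ (J.card - 1) * Y a = (∑ b ∈ J.erase a, Y b) ^ (J.card - 1) * Y a := by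
      rw [hP']
      exact add_pow_mul rfl (h.sum_commute_sum _ _ a) (h.sum_comm_mul _ a) (h.sq a) _
    have e2 : (Q * Y a - Y a * Q) * P ^ (J.card - 1) =
        (Q * Y a - Y a * Q) * (∑ b ∈ J.erase a, Y b) ^ (J.card - 1) := by
      rw [hP']
      exact mul_add_pow_of_mul_eq_zero (h.sum_commute_sum _ _ a) (h.sum_comm_mul _ a) _
    have e3 : Commute (Q * Y a - Y a * Q) ((∑ b ∈ J.erase a, Y b) ^ (J.card - 1)) :=
      (h.sum_commute_sum I _ a).pow_right _
    rw [h.symProd_insert' (Finset.disjoint_left.1 hJI ha), symProd, Finset.card_erase_of_mem ha, e1,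
      ← mul_assoc (Q * Y a - Y a * Q), e2, mul_add, mul_smul_comm, mul_smul_comm, e3.eq]
    simp only [mul_assoc]
    rfl
  rw [Finset.sum_congr rfl key, Finset.sum_add_distrib, ← Finset.smul_sum, ← Finset.smul_sum,
    ← Finset.sum_mul, ← Finset.mul_sum, ← Finset.sum_mul, Finset.sum_sub_distrib, ← Finset.mul_sum,
    ← Finset.sum_mul, ← hP, ← pow_succ, Nat.sub_add_cancel hJ.card_pos, ← neg_sub (P * Q), neg_mul,
    smul_neg, ← sub_eq_add_neg]
  rfl

variable [Fintype T]

/-- The span of the products of two symmetrized products in which the right-hand factor has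
more than `k` labels. -/
def longSpan (Y : T → R) (k : ℕ) : Submodule ℂ R :=
  Submodule.span ℂ {x | ∃ J : Finset T, k < Jᶜ.card ∧ x = symProd Y J * symProd Y Jᶜ}

theorem mem_longSpan (Y : T → R) {k : ℕ} {J : Finset T} (h : k < Jᶜ.card) :
    symProd Y J * symProd Y Jᶜ ∈ longSpan Y k :=
  Submodule.subset_span ⟨J, h, rfl⟩

/-- Transferring labels of `J` to the right lengthens the right factor, so `exchange_right` places
the common correction term in `longSpan`, its coefficient being nonzero as `Jᶜ` is nonempty. Then
`exchange_left` gives the claim. -/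
theorem exchange_mem (h : NilHeisenberg Y) {k : ℕ} {J : Finset T} (hJ : k < Jᶜ.card) :
    ∑ a ∈ Jᶜ, symProd Y (insert a J) * symProd Y (insert a J)ᶜ ∈ longSpan Y k := by
  have hne : Jᶜ.Nonempty := Finset.card_pos.1 (by omega)
  have e0 : ∀ a ∈ Jᶜ, symProd Y (insert a J) * symProd Y (insert a J)ᶜ =
      symProd Y (insert a J) * symProd Y (Jᶜ.erase a) := by
    intro a _
    rw [Finset.compl_insert]
  rw [Finset.sum_congr rfl e0, h.exchange_left disjoint_compl_right hne]
  refine Submodule.sub_mem _ (Submodule.smul_mem _ _ (mem_longSpan Y hJ)) ?_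
  -- For empty `J` the correction term has coefficient zero.
  rcases J.eq_empty_or_nonempty with rfl | hJne
  · simp
  have h2 := h.exchange_right (disjoint_compl_right (a := J)) hJne
  have h3 : ∑ a ∈ J, symProd Y (J.erase a) * symProd Y (insert a Jᶜ) ∈ longSpan Y k := by
    refine Submodule.sum_mem _ fun a ha => ?_
    have : insert a Jᶜ = (J.erase a)ᶜ := by rw [Finset.compl_erase]
    rw [this]
    refine mem_longSpan Y (hJ.trans_le (Finset.card_le_card ?_))
    exact Finset.compl_subset_compl.2 (Finset.erase_subset _ _)
  rw [h2, Submodule.sub_mem_iff_right _ (Submodule.smul_mem _ _ (mem_longSpan Y hJ))] at h3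
  refine Submodule.smul_mem _ _ ((Submodule.smul_mem_iff _ ?_).1 h3)
  have h4 : (Jᶜ.card : ℂ) ≠ 0 := Nat.cast_ne_zero.2 (by omega)
  have h5 : (Jᶜ.card : ℂ) + 1 ≠ 0 := by exact_mod_cast Nat.succ_ne_zero Jᶜ.card
  exact div_ne_zero (mul_ne_zero h5 h4) two_ne_zero

/-- The Garnir relations. -/
theorem garnir (h : NilHeisenberg Y) {k : ℕ} {K : Finset T} (hK : k < K.card) (j : ℕ) :
    ∀ A ⊆ Kᶜ, j + A.card + k = Fintype.card T →
      ∑ L ∈ K.powersetCard j, symProd Y (L ∪ A) * symProd Y (L ∪ A)ᶜ ∈ longSpan Y k := by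
  induction j with
  | zero =>
    intro A hA hcard
    -- The base case is vacuous: `A` lies outside `K` and `k < K.card`, so `A` is too small for
    -- `hcard`.
    have := Finset.card_le_card hA
    rw [Finset.card_compl] at this
    have := Finset.card_le_univ K
    omega
  | succ j ih =>
    intro A hA hcard
    set c : Finset T → R := fun J => symProd Y J * symProd Y Jᶜ with hc
    have hdisj : ∀ L ⊆ K, Disjoint L A := fun L hL =>
      Finset.disjoint_of_subset_left hL (Finset.disjoint_of_subset_right hA disjoint_compl_right)
    -- Add up the exchange relations of all `L` of size `j`; by `hcard` each right factor has `k +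
    -- 1` labels. The transferred label lies either in `K`, so that every subset of size `j + 1` is
    -- met `j + 1` times, or outside `K`, where it enlarges `A` and the induction hypothesis
    -- applies.
    have h1 : ∑ L ∈ K.powersetCard j, ∑ a ∈ (L ∪ A)ᶜ, c (insert a (L ∪ A)) ∈ longSpan Y k := by
      refine Submodule.sum_mem _ fun L hL => h.exchange_mem ?_
      obtain ⟨hLK, hLc⟩ := Finset.mem_powersetCard.1 hL
      rw [Finset.card_compl, Finset.card_union_of_disjoint (hdisj L hLK)]
      omega
    have h2 : ∀ L ∈ K.powersetCard j, ∑ a ∈ (L ∪ A)ᶜ, c (insert a (L ∪ A)) =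
        ∑ a ∈ K \ L, c (insert a L ∪ A) + ∑ a ∈ Kᶜ \ A, c (L ∪ insert a A) := by
      intro L hL
      obtain ⟨hLK, -⟩ := Finset.mem_powersetCard.1 hL
      have e1 : (L ∪ A)ᶜ = K \ L ∪ Kᶜ \ A := by
        ext x
        have := @hA x
        have := @hLK x
        simp only [Finset.mem_compl, Finset.mem_union, Finset.mem_sdiff] at *
        tauto
      rw [e1, Finset.sum_union]
      · simp only [Finset.insert_union, Finset.union_insert]
      · exact Finset.disjoint_of_subset_left Finset.sdiff_subset
          (Finset.disjoint_of_subset_right Finset.sdiff_subset disjoint_compl_right)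
    rw [Finset.sum_congr rfl h2, Finset.sum_add_distrib,
      sum_powersetCard_insert K j fun L => c (L ∪ A), Finset.sum_comm] at h1
    have h3 : ∑ a ∈ Kᶜ \ A, ∑ L ∈ K.powersetCard j, c (L ∪ insert a A) ∈ longSpan Y k := by
      refine Submodule.sum_mem _ fun a ha => ?_
      rw [Finset.mem_sdiff] at ha
      refine ih (insert a A) (Finset.insert_subset ha.1 hA) ?_
      rw [Finset.card_insert_of_notMem ha.2]
      omega
    rw [Submodule.add_mem_iff_left _ h3, ← Finset.smul_sum, ← Nat.cast_smul_eq_nsmul ℂ] at h1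
    exact (Submodule.smul_mem_iff _ (Nat.cast_ne_zero.2 (Nat.succ_ne_zero j))).1 h1

end NilHeisenberg

end NilpotentHeisenberg

/-! ### Column operators as powers, by means of Grassmann variables. -/

section Grassmann

variable {T : Type*} [Fintype T] [DecidableEq T]

/-- The generators of the Grassmann algebra on the set `T`. -/
def grassmannGen (a : T) : ExteriorAlgebra ℂ (T → ℂ) := ExteriorAlgebra.ι ℂ (Pi.single a 1)

theorem grassmannGen_swap (a b : T) :
    grassmannGen b * grassmannGen a = -(grassmannGen a * grassmannGen b) :=
  (neg_eq_of_add_eq_zero_right (ExteriorAlgebra.ι_add_mul_swap _ _)).symm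

theorem grassmannGen_sq (a : T) : grassmannGen a * grassmannGen a = 0 :=
  ExteriorAlgebra.ι_sq_zero _

/-- The product of Grassmann generators as a function of the tuple of labels. -/
def grassmannProd {k : ℕ} (w : Fin k → T) : ExteriorAlgebra ℂ (T → ℂ) :=
  (List.ofFn fun r => grassmannGen (w r)).prod

theorem grassmannProd_eq {k : ℕ} (w : Fin k → T) :
    grassmannProd w = ExteriorAlgebra.ιMulti ℂ k fun r => Pi.single (w r) (1 : ℂ) := by
  rw [ExteriorAlgebra.ιMulti_apply]
  rfl

theorem grassmannProd_eq_zero {k : ℕ} {w : Fin k → T} (hw : ¬ Function.Injective w) :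
    grassmannProd w = 0 := by
  rw [grassmannProd_eq]
  refine AlternatingMap.map_eq_zero_of_not_injective _ _ fun h => hw ?_
  exact Function.Injective.of_comp (f := fun a => (Pi.single a 1 : T → ℂ)) h

theorem grassmannProd_comp_perm {k : ℕ} (w : Fin k → T) (σ : Equiv.Perm (Fin k)) :
    grassmannProd (fun r => w (σ r)) = ((Equiv.Perm.sign σ : ℤˣ) : ℤ) • grassmannProd w := by
  rw [grassmannProd_eq, grassmannProd_eq]
  exact AlternatingMap.map_perm _ (fun r => (Pi.single (w r) 1 : T → ℂ)) σ

theorem grassmannProd_append {k l : ℕ} (w : Fin k → T) (w' : Fin l → T) :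
    grassmannProd (Fin.append w w') = grassmannProd w * grassmannProd w' := by
  unfold grassmannProd
  have : (fun r => grassmannGen (Fin.append w w' r)) =
      Fin.append (fun r => grassmannGen (w r)) (fun r => grassmannGen (w' r)) := by
    funext r
    refine Fin.addCases (fun i => ?_) (fun i => ?_) r <;> simp
  rw [this, List.ofFn_fin_append, List.prod_append]

theorem grassmannProd_ne_zero {k : ℕ} {w : Fin k → T} (hw : Function.Injective w) :
    grassmannProd w ≠ 0 := by
  intro h
  -- The minor in the coordinates `w` is an alternating form with value `1` on the given vectors; it
  -- factors through the exterior algebra.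
  let f : (T → ℂ) [⋀^Fin k]→ₗ[ℂ] ℂ :=
    (Matrix.detRowAlternating (n := Fin k) (R := ℂ)).compLinearMap (LinearMap.funLeft ℂ ℂ w)
  have h1 := ExteriorAlgebra.liftAlternating_apply_ιMulti (R := ℂ) (Pi.single k f)
    (fun r => Pi.single (w r) (1 : ℂ))
  rw [← grassmannProd_eq, h, map_zero, Pi.single_eq_same] at h1
  have h2 : f (fun r => Pi.single (w r) (1 : ℂ)) = (1 : Matrix (Fin k) (Fin k) ℂ).det := by
    change Matrix.det (fun r => (LinearMap.funLeft ℂ ℂ w) (Pi.single (w r) (1 : ℂ))) = _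
    congr 1
    ext i j
    simp [LinearMap.funLeft_apply, Pi.single_apply, Matrix.one_apply, hw.eq_iff, eq_comm]
  rw [h2, Matrix.det_one] at h1
  exact zero_ne_one h1

variable {n : ℕ} {A : Type*} [Ring A] [Algebra ℂ A] (b : Fin n → A) (f : T → Fin n)

/-- The elements `b_{f(a)} ⊗ η_a`. -/
def labelled (a : T) : A ⊗[ℂ] ExteriorAlgebra ℂ (T → ℂ) := b (f a) ⊗ₜ grassmannGen a

/-- Since the `η_a` anticommute, the commutator of `b ⊗ η` and `b' ⊗ η'` is `{b, b'} ⊗ η η'`. The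
first factor is central by hypothesis, and the second is even and killed by `η'`. -/
theorem nilHeisenberg_labelled (hb : ∀ i j k, Commute (anticomm (b i) (b j)) (b k)) :
    NilHeisenberg (labelled b f) := by
  have key : ∀ x y, labelled b f x * labelled b f y - labelled b f y * labelled b f x =
      anticomm (b (f x)) (b (f y)) ⊗ₜ (grassmannGen x * grassmannGen y) := by
    intro x y
    simp only [labelled, Algebra.TensorProduct.tmul_mul_tmul, anticomm]
    rw [grassmannGen_swap x y, TensorProduct.tmul_neg, sub_neg_eq_add, ← TensorProduct.add_tmul]
  constructor
  · intro x y z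
    rw [key, Commute, SemiconjBy, labelled, Algebra.TensorProduct.tmul_mul_tmul,
      Algebra.TensorProduct.tmul_mul_tmul, (hb _ _ _).eq]
    congr 1
    rw [mul_assoc, grassmannGen_swap z y, mul_neg, ← mul_assoc, grassmannGen_swap z x, neg_mul,
      neg_neg, mul_assoc]
  · intro x
    simp [labelled, grassmannGen_sq]
  · intro x y
    rw [key, labelled, Algebra.TensorProduct.tmul_mul_tmul, mul_assoc, grassmannGen_sq]
    simp

/-- Expanding the power, the Grassmann factor kills the words with a repeated position and supplies
the sign of the permutation in the others. -/
theorem sum_labelled_pow {k : ℕ} (w : Fin k → T) :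
    (∑ r, labelled b f (w r)) ^ k = columnOp b (f ∘ w) ⊗ₜ grassmannProd w := by
  have h1 : (∑ r, labelled b f (w r)) ^ k =
      (List.ofFn fun _ : Fin k => ∑ r, labelled b f (w r)).prod := by
    rw [List.ofFn_const, List.prod_replicate]
  rw [h1, list_prod_ofFn_sum]
  simp only [labelled, list_prod_ofFn_tmul]
  rw [sum_fun_eq_sum_perm, columnOp, TensorProduct.sum_tmul]
  · refine Finset.sum_congr rfl fun σ _ => ?_
    have h2 := grassmannProd_comp_perm w σ
    unfold grassmannProd at h2
    rw [h2, TensorProduct.smul_tmul]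
    rfl
  · intro u hu
    have := grassmannProd_eq_zero (w := fun r => w (u r)) fun h => hu (Function.Injective.of_comp (f := w) h)
    unfold grassmannProd at this
    rw [this, TensorProduct.tmul_zero]

/-- An enumeration of a finite set. -/
def enum (S : Finset T) (r : Fin S.card) : T := S.equivFin.symm r

theorem enum_injective (S : Finset T) : Function.Injective (enum S) :=
  Subtype.val_injective.comp S.equivFin.symm.injective

theorem enum_mem (S : Finset T) (r : Fin S.card) : enum S r ∈ S := (S.equivFin.symm r).2

theorem sum_enum {M : Type*} [AddCommMonoid M] (S : Finset T) (g : T → M) :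
    ∑ r, g (enum S r) = ∑ a ∈ S, g a := by
  unfold enum
  rw [Equiv.sum_comp S.equivFin.symm (fun a : S => g a), Finset.sum_coe_sort]

theorem image_enum (S : Finset T) : Finset.univ.image (enum S) = S := by
  ext a
  simp only [Finset.mem_image, Finset.mem_univ, true_and]
  constructor
  · rintro ⟨r, rfl⟩
    exact enum_mem S r
  · intro h
    exact ⟨S.equivFin ⟨a, h⟩, by simp [enum]⟩

theorem symProd_labelled (S : Finset T) :
    NilHeisenberg.symProd (labelled b f) S =
      columnOp b (f ∘ enum S) ⊗ₜ grassmannProd (enum S) := by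
  rw [NilHeisenberg.symProd, ← sum_enum, sum_labelled_pow]

/-- Contracting the Garnir relation with a functional on the Grassmann algebra brings it down to
`A`. The functional only has to be nonzero on the monomial belonging to `K₀`: the scalars of the
other terms do not matter, as those terms lie in `N` anyway. -/
theorem columnOp_mul_columnOp_mem (hb : ∀ i j k, Commute (anticomm (b i) (b j)) (b k))
    {k : ℕ} {K A₀ K₀ : Finset T} (hK : k < K.card) (hA : A₀ ⊆ Kᶜ) (hK₀ : K₀ ⊆ K)
    (hcard : K₀.card + A₀.card + k = Fintype.card T) (N : Submodule ℂ A)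
    (hlong : ∀ J : Finset T, k < Jᶜ.card →
      columnOp b (f ∘ enum J) * columnOp b (f ∘ enum Jᶜ) ∈ N)
    (hother : ∀ L ⊆ K, L.card = K₀.card → L ≠ K₀ →
      columnOp b (f ∘ enum (L ∪ A₀)) * columnOp b (f ∘ enum (L ∪ A₀)ᶜ) ∈ N) :
    columnOp b (f ∘ enum (K₀ ∪ A₀)) * columnOp b (f ∘ enum (K₀ ∪ A₀)ᶜ) ∈ N := by
  have hne : grassmannProd (enum (K₀ ∪ A₀)) * grassmannProd (enum (K₀ ∪ A₀)ᶜ) ≠ 0 := by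
    rw [← grassmannProd_append]
    refine grassmannProd_ne_zero (Fin.append_injective_iff.2 ⟨enum_injective _, enum_injective _, ?_⟩)
    intro r s h
    exact (Finset.mem_compl.1 (enum_mem _ s)) (h ▸ enum_mem _ r)
  obtain ⟨φ, hφ⟩ := Module.Projective.exists_dual_ne_zero ℂ hne
  let ψ : A ⊗[ℂ] ExteriorAlgebra ℂ (T → ℂ) →ₗ[ℂ] A :=
    (TensorProduct.rid ℂ A).toLinearMap ∘ₗ TensorProduct.map LinearMap.id φ
  have hψ : ∀ J : Finset T, ∃ z : ℂ, z = φ (grassmannProd (enum J) * grassmannProd (enum Jᶜ)) ∧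
      ψ (NilHeisenberg.symProd (labelled b f) J * NilHeisenberg.symProd (labelled b f) Jᶜ) =
        z • (columnOp b (f ∘ enum J) * columnOp b (f ∘ enum Jᶜ)) := by
    intro J
    refine ⟨_, rfl, ?_⟩
    rw [symProd_labelled, symProd_labelled, Algebra.TensorProduct.tmul_mul_tmul]
    simp [ψ]
  have hlong' : ∀ x ∈ NilHeisenberg.longSpan (labelled b f) k, ψ x ∈ N := by
    intro x hx
    refine Submodule.span_induction (p := fun x _ => ψ x ∈ N) ?_ (by simp) ?_ ?_ hx
    · rintro x ⟨J, hJ, rfl⟩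
      obtain ⟨z, -, hz⟩ := hψ J
      rw [hz]
      exact N.smul_mem _ (hlong J hJ)
    · intro x y _ _ hx hy
      rw [map_add]
      exact N.add_mem hx hy
    · intro z x _ hx
      rw [map_smul]
      exact N.smul_mem _ hx
  have h1 := hlong' _ ((nilHeisenberg_labelled b f hb).garnir hK K₀.card A₀ hA hcard)
  rw [map_sum, ← Finset.add_sum_erase _ _ (Finset.mem_powersetCard.2 ⟨hK₀, rfl⟩)] at h1
  have h2 : ∑ L ∈ (K.powersetCard K₀.card).erase K₀,
      ψ (NilHeisenberg.symProd (labelled b f) (L ∪ A₀) *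
        NilHeisenberg.symProd (labelled b f) (L ∪ A₀)ᶜ) ∈ N := by
    refine N.sum_mem fun L hL => ?_
    rw [Finset.mem_erase, Finset.mem_powersetCard] at hL
    obtain ⟨z, -, hz⟩ := hψ (L ∪ A₀)
    rw [hz]
    exact N.smul_mem _ (hother L hL.2.1 hL.2.2 hL.1)
  rw [N.add_mem_iff_left h2] at h1
  obtain ⟨z, hz1, hz⟩ := hψ (K₀ ∪ A₀)
  rw [hz] at h1
  exact (N.smul_mem_iff (hz1 ▸ hφ)).1 h1

end Grassmann

/-! ### Straightening of products of columns. -/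

section Straightening

variable {n : ℕ}

/-- Two columns, `S` to the left of `S'`, are standard if they fit into a semistandard tableau. -/
def Std (S S' : Finset (Fin n)) : Prop :=
  ∀ x, (S'.filter (· ≤ x)).card ≤ (S.filter (· ≤ x)).card

theorem Std.trans {S S' S'' : Finset (Fin n)} (h : Std S S') (h' : Std S' S'') : Std S S'' :=
  fun x => (h' x).trans (h x)

theorem Std.orderEmbOfFin_le {S S' : Finset (Fin n)} (h : Std S S') {r : ℕ} (hr : r < S'.card) :
    ∃ hr' : r < S.card, S.orderEmbOfFin rfl ⟨r, hr'⟩ ≤ S'.orderEmbOfFin rfl ⟨r, hr⟩ := by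
  set x := S'.orderEmbOfFin rfl ⟨r, hr⟩ with hx
  have h1 : r + 1 ≤ (S'.filter (· ≤ x)).card := by
    have : ((Finset.Iic (⟨r, hr⟩ : Fin S'.card)).map (S'.orderEmbOfFin rfl).toEmbedding) ⊆
        S'.filter (· ≤ x) := by
      intro y hy
      simp only [Finset.mem_map, Finset.mem_Iic] at hy
      obtain ⟨s, hs, rfl⟩ := hy
      rw [Finset.mem_filter]
      exact ⟨Finset.orderEmbOfFin_mem _ _ _, (S'.orderEmbOfFin rfl).monotone hs⟩
    have h2 := Finset.card_le_card this
    rwa [Finset.card_map, Fin.card_Iic] at h2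
  have h2 := h1.trans (h x)
  have hr' : r < S.card := lt_of_lt_of_le (Nat.lt_of_succ_le h2) (Finset.card_filter_le _ _)
  refine ⟨hr', ?_⟩
  by_contra hlt
  rw [not_le] at hlt
  have : S.filter (· ≤ x) ⊆
      ((Finset.Iio (⟨r, hr'⟩ : Fin S.card)).map (S.orderEmbOfFin rfl).toEmbedding) := by
    intro y hy
    rw [Finset.mem_filter] at hy
    have hy1 : y ∈ Set.range (S.orderEmbOfFin rfl) := by
      rw [Finset.range_orderEmbOfFin]
      exact hy.1
    obtain ⟨s, rfl⟩ := hy1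
    rw [Finset.mem_map]
    refine ⟨s, ?_, rfl⟩
    rw [Finset.mem_Iio]
    exact (S.orderEmbOfFin rfl).lt_iff_lt.1 (hy.2.trans_lt hlt)
  have h3 := Finset.card_le_card this
  rw [Finset.card_map, Fin.card_Iio] at h3
  simp only at h3
  omega

theorem sum_lt_sum_of_card_eq {T : Type*} [DecidableEq T] {K L : Finset T} {g : T → ℕ} {x : ℕ}
    (hc : L.card = K.card) (hne : L ≠ K) (hK : ∀ a ∈ K, g a ≤ x)
    (hL : ∀ a ∈ L, a ∉ K → x < g a) : ∑ a ∈ K, g a < ∑ a ∈ L, g a := by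
  have h1 : (L \ K).Nonempty := by
    rw [Finset.sdiff_nonempty]
    exact fun h => hne (Finset.eq_of_subset_of_card_le h hc.ge)
  have h2 : (K \ L).card = (L \ K).card := Finset.card_sdiff_comm hc.symm
  rw [← Finset.sum_inter_add_sum_sdiff K L, ← Finset.sum_inter_add_sum_sdiff L K, Finset.inter_comm]
  refine Nat.add_lt_add_left ?_ _
  calc ∑ a ∈ K \ L, g a ≤ (K \ L).card • x :=
        Finset.sum_le_card_nsmul _ _ _ fun a ha => hK a (Finset.mem_sdiff.1 ha).1
    _ = ∑ a ∈ L \ K, x := by rw [h2, Finset.sum_const]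
    _ < ∑ a ∈ L \ K, g a := Finset.sum_lt_sum_of_nonempty h1 fun a ha =>
        hL a (Finset.mem_sdiff.1 ha).1 (Finset.mem_sdiff.1 ha).2

/-- The product of the column operators of a list of columns, the first column acting first. -/
def columnsProd {R : Type*} [Ring R] (b : Fin n → R) (cs : List (Finset (Fin n))) : R :=
  (cs.map (columnSet b)).reverse.prod

theorem columnsProd_cons {R : Type*} [Ring R] (b : Fin n → R) (S : Finset (Fin n))
    (cs : List (Finset (Fin n))) : columnsProd b (S :: cs) = columnsProd b cs * columnSet b S := by
  simp [columnsProd]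

theorem columnsProd_append {R : Type*} [Ring R] (b : Fin n → R) (cs cs' : List (Finset (Fin n))) :
    columnsProd b (cs ++ cs') = columnsProd b cs' * columnsProd b cs := by
  simp [columnsProd]

variable {A : Type*} [Ring A] [Algebra ℂ A] (b : Fin n → A)

theorem columnOp_enum {T : Type*} [Fintype T] [DecidableEq T] (f : T → Fin n) (J : Finset T) :
    columnOp b (f ∘ enum J) = 0 ∨
      ((J.image f).card = J.card ∧ ∑ i ∈ J.image f, (i : ℕ) = ∑ a ∈ J, (f a : ℕ) ∧
        ∃ u : ℤˣ, columnOp b (f ∘ enum J) = (u : ℤ) • columnSet b (J.image f)) := by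
  by_cases h : Function.Injective (f ∘ enum J)
  · right
    have himg : Finset.univ.image (f ∘ enum J) = J.image f := by
      rw [← Finset.image_image, image_enum]
    have hinj : Set.InjOn f J := by
      intro a ha a' ha' haa
      rw [← image_enum J, Finset.coe_image, Finset.coe_univ, Set.image_univ] at ha ha'
      obtain ⟨r, rfl⟩ := ha
      obtain ⟨r', rfl⟩ := ha'
      rw [h haa]
    refine ⟨Finset.card_image_of_injOn hinj, Finset.sum_image hinj, ?_⟩
    rw [← himg]
    exact columnOp_eq_columnSet b h
  · left
    exact columnOp_eq_zero b h

/-- The straightening relation for two columns that are not standard. -/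
theorem columnSet_mul_columnSet_mem (hb : ∀ i j k, Commute (anticomm (b i) (b j)) (b k))
    {S S' : Finset (Fin n)} (h : ¬ Std S S') :
    columnSet b S' * columnSet b S ∈ Submodule.span ℂ {x | ∃ U U' : Finset (Fin n),
      (S.card < U.card ∨ (U.card = S.card ∧ ∑ i ∈ U, (i : ℕ) < ∑ i ∈ S, (i : ℕ))) ∧
        x = columnSet b U' * columnSet b U} := by
  set N := Submodule.span ℂ {x | ∃ U U' : Finset (Fin n),
      (S.card < U.card ∨ (U.card = S.card ∧ ∑ i ∈ U, (i : ℕ) < ∑ i ∈ S, (i : ℕ))) ∧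
        x = columnSet b U' * columnSet b U} with hN
  have hmem : ∀ {U U' : Finset (Fin n)},
      (S.card < U.card ∨ (U.card = S.card ∧ ∑ i ∈ U, (i : ℕ) < ∑ i ∈ S, (i : ℕ))) →
        columnSet b U' * columnSet b U ∈ N := fun hU => Submodule.subset_span ⟨_, _, hU, rfl⟩
  simp only [Std, not_forall, not_le] at h
  obtain ⟨x, hx⟩ := h
  -- The labels form a disjoint union because the two columns may share entries; terms with a
  -- repeated entry in one factor vanish.
  let f : S' ⊕ S → Fin n := Sum.elim Subtype.val Subtype.val
  -- The Garnir set: the entries `≤ x` of `S'` and the entries `> x` of `S`. The violation of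
  -- standardness at `x` says exactly that it has more than `|S|` elements.
  let K : Finset (S' ⊕ S) := Finset.univ.filter fun a =>
    Sum.elim (fun a : S' => decide ((a : Fin n) ≤ x)) (fun a : S => decide (x < (a : Fin n))) a
  let K₀ : Finset (S' ⊕ S) := Finset.univ.filter fun a =>
    Sum.elim (fun a : S' => decide ((a : Fin n) ≤ x)) (fun _ : S => false) a
  let A₀ : Finset (S' ⊕ S) := Finset.univ.filter fun a =>
    Sum.elim (fun a : S' => decide (x < (a : Fin n))) (fun _ : S => false) a
  have hsum : ∀ (V : Finset (Fin n)) (q : Fin n → Prop) [DecidablePred q],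
      (∑ a : V, if q a then 1 else 0) = (V.filter q).card := by
    intro V q _
    rw [Finset.sum_coe_sort V fun a => if q a then 1 else 0, Finset.card_filter]
  have hsplit : ∀ V : Finset (Fin n), (V.filter (· ≤ x)).card + (V.filter (x < ·)).card = V.card := by
    intro V
    simpa only [not_le] using Finset.card_filter_add_card_filter_not (s := V) (· ≤ x)
  have hcard : ∀ g : S' ⊕ S → Bool, (Finset.univ.filter fun a => g a = true).card =
      (∑ a : S', if g (Sum.inl a) = true then 1 else 0) +
        ∑ a : S, if g (Sum.inr a) = true then 1 else 0 := by
    intro g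
    rw [Finset.card_filter, Fintype.sum_sum_type]
  have hKc : K.card = (S'.filter (· ≤ x)).card + (S.filter (x < ·)).card := by
    rw [hcard, ← hsum S' (· ≤ x), ← hsum S (x < ·)]
    simp
  have hK₀c : K₀.card = (S'.filter (· ≤ x)).card := by
    rw [hcard, ← hsum S' (· ≤ x)]
    simp
  have hA₀c : A₀.card = (S'.filter (x < ·)).card := by
    rw [hcard, ← hsum S' (x < ·)]
    simp
  have hT : Fintype.card (S' ⊕ S) = S'.card + S.card := by simp
  have hUn : ∀ a : S' ⊕ S, a ∈ K₀ ∪ A₀ ↔ a.isLeft := by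
    rintro (a | a)
    · simp [K₀, A₀, le_or_gt]
    · simp [K₀, A₀]
  have hdisj : ∀ L ⊆ K, Disjoint L A₀ := by
    intro L hL
    refine Finset.disjoint_of_subset_left hL (Finset.disjoint_left.2 ?_)
    rintro (a | a)
    · simp [K, A₀]
    · simp [K, A₀]
  have himg : (K₀ ∪ A₀).image f = S' := by
    ext i
    simp only [Finset.mem_image, hUn]
    constructor
    · rintro ⟨a | a, ha, rfl⟩
      · exact a.2
      · simp at ha
    · intro hi
      exact ⟨Sum.inl ⟨i, hi⟩, rfl, rfl⟩
  have himg' : (K₀ ∪ A₀)ᶜ.image f = S := by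
    ext i
    simp only [Finset.mem_image, Finset.mem_compl, hUn]
    constructor
    · rintro ⟨a | a, ha, rfl⟩
      · simp at ha
      · exact a.2
    · intro hi
      exact ⟨Sum.inr ⟨i, hi⟩, by simp, rfl⟩
  have hsumcompl : ∀ J : Finset (S' ⊕ S),
      ∑ a ∈ J, (f a : ℕ) + ∑ a ∈ Jᶜ, (f a : ℕ) = ∑ a, (f a : ℕ) := fun J => Finset.sum_add_sum_compl J _
  have hK₀A₀ : (K₀ ∪ A₀).card = S'.card := by
    rw [Finset.card_union_of_disjoint (hdisj K₀ ?_), hK₀c, hA₀c, hsplit]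
    rintro (a | a)
    · simp [K, K₀]
    · simp [K₀]
  have hK₀K : K₀ ⊆ K := by
    rintro (a | a)
    · simp [K, K₀]
    · simp [K₀]
  have hfinj : ∀ J : Finset (S' ⊕ S), (J.image f).card = J.card → Set.InjOn f J := fun J =>
    Finset.injOn_of_card_image_eq
  have main : columnOp b (f ∘ enum (K₀ ∪ A₀)) * columnOp b (f ∘ enum (K₀ ∪ A₀)ᶜ) ∈ N := by
    refine columnOp_mul_columnOp_mem b f hb (k := S.card) (K := K) ?_ ?_ hK₀K ?_ N ?_ ?_
    · have := hsplit S
      omega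
    · intro a ha
      rw [Finset.mem_compl]
      exact fun h => Finset.disjoint_left.1 (hdisj K le_rfl) h ha
    · have := hsplit S'
      omega
    · intro J hJ
      rcases columnOp_enum b f J with h1 | ⟨-, -, u, h1⟩
      · rw [h1, zero_mul]
        exact N.zero_mem
      rcases columnOp_enum b f Jᶜ with h2 | ⟨hc, -, u', h2⟩
      · rw [h2, mul_zero]
        exact N.zero_mem
      rw [h1, h2, smul_mul_assoc, mul_smul_comm]
      refine zsmul_mem (zsmul_mem (hmem ?_) _) _
      rw [hc]
      exact Or.inl hJ
    · intro L hLK hLc hLne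
      rcases columnOp_enum b f (L ∪ A₀) with h1 | ⟨-, -, u, h1⟩
      · rw [h1, zero_mul]
        exact N.zero_mem
      rcases columnOp_enum b f (L ∪ A₀)ᶜ with h2 | ⟨hc, hs, u', h2⟩
      · rw [h2, mul_zero]
        exact N.zero_mem
      rw [h1, h2, smul_mul_assoc, mul_smul_comm]
      refine zsmul_mem (zsmul_mem (hmem (Or.inr ⟨?_, ?_⟩)) _) _
      · rw [hc, Finset.card_compl, Finset.card_union_of_disjoint (hdisj L hLK), hLc,
          ← Finset.card_union_of_disjoint (hdisj K₀ hK₀K), hK₀A₀, hT, Nat.add_sub_cancel_left]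
      · rw [hs]
        -- Replacing `K₀` by another `L` of the same size moves entries `> x` into the left factor
        -- in place of entries `≤ x`, so the entry sum of the complementary factor, which is the new
        -- left column, decreases.
        have h3 : ∑ a ∈ K₀, (f a : ℕ) < ∑ a ∈ L, (f a : ℕ) := by
          refine sum_lt_sum_of_card_eq (x := (x : ℕ)) hLc hLne ?_ ?_
          · rintro (a | a)
            · simp [K₀, f]
            · simp [K₀]
          · rintro (a | a) haL haK
            · have := hLK haL
              simp [K, K₀] at this haK
              exact absurd this (not_le.2 haK)
            · have := hLK haL
              simpa [K, f] using this
        have h4 := hsumcompl (L ∪ A₀)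
        have h5 := hsumcompl (K₀ ∪ A₀)
        rw [Finset.sum_union (hdisj L hLK)] at h4
        rw [Finset.sum_union (hdisj K₀ hK₀K)] at h5
        have h6 : ∑ a ∈ (K₀ ∪ A₀)ᶜ, (f a : ℕ) = ∑ i ∈ S, (i : ℕ) := by
          conv_rhs => rw [← himg']
          refine (Finset.sum_image (hfinj _ ?_)).symm
          rw [himg', Finset.card_compl, hK₀A₀, hT, Nat.add_sub_cancel_left]
        omega
  have hu : ∀ (u : ℤˣ) (z : A), (u : ℤ) • z ∈ N → z ∈ N := by
    intro u z hz
    rcases Int.units_eq_one_or u with rfl | rfl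
    · simpa using hz
    · simpa using hz
  have hinj : ∀ J : Finset (S' ⊕ S), (J.image f).card = J.card → 
      ∃ u : ℤˣ, columnOp b (f ∘ enum J) = (u : ℤ) • columnSet b (J.image f) := by
    intro J hJ
    have h1 : Function.Injective (f ∘ enum J) := fun r s hrs =>
      enum_injective J (hfinj J hJ (enum_mem J r) (enum_mem J s) hrs)
    have himg : Finset.univ.image (f ∘ enum J) = J.image f := by
      rw [← Finset.image_image, image_enum]
    rw [← himg]
    exact columnOp_eq_columnSet b h1
  obtain ⟨u, h1⟩ := hinj (K₀ ∪ A₀) (by rw [himg, hK₀A₀])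
  obtain ⟨u', h2⟩ := hinj (K₀ ∪ A₀)ᶜ
    (by rw [himg', Finset.card_compl, hK₀A₀, hT, Nat.add_sub_cancel_left])
  rw [h1, h2, smul_mul_assoc, mul_smul_comm, himg, himg'] at main
  exact hu _ _ (hu _ _ main)

/-- The potential of a column, which is lower for longer columns, and among the columns of the same
length for those with smaller entries. -/
def potential (S : Finset (Fin n)) : ℕ := (n - S.card) * (n * n + 1) + ∑ i ∈ S, (i : ℕ)

theorem sum_val_le (S : Finset (Fin n)) : ∑ i ∈ S, (i : ℕ) ≤ n * n := by
  calc ∑ i ∈ S, (i : ℕ) ≤ S.card • n := Finset.sum_le_card_nsmul _ _ _ fun i _ => i.2.le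
    _ ≤ n * n := Nat.mul_le_mul_right _ (card_finset_fin_le S)

/-- This bound is the base of the positional system in `listPotential`, so that a decrease at one
column outweighs any change in the columns after it. -/
theorem potential_lt (S : Finset (Fin n)) : potential S < (n + 1) * (n * n + 1) := by
  have h1 := sum_val_le S
  have h2 : (n - S.card) * (n * n + 1) ≤ n * (n * n + 1) := Nat.mul_le_mul_right _ (Nat.sub_le _ _)
  unfold potential
  rw [add_mul n 1]
  omega

theorem potential_lt_potential {S U : Finset (Fin n)}
    (h : S.card < U.card ∨ (U.card = S.card ∧ ∑ i ∈ U, (i : ℕ) < ∑ i ∈ S, (i : ℕ))) :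
    potential U < potential S := by
  unfold potential
  rcases h with h | ⟨h, h'⟩
  · have h1 := sum_val_le U
    have h2 := card_finset_fin_le U
    have h3 : (n - U.card + 1) * (n * n + 1) ≤ (n - S.card) * (n * n + 1) :=
      Nat.mul_le_mul_right _ (by omega)
    rw [add_mul] at h3
    omega
  · rw [h]
    omega

/-- The lexicographic potential of a list of columns. -/
def listPotential : List (Finset (Fin n)) → ℕ
  | [] => 0
  | S :: cs => potential S * ((n + 1) * (n * n + 1)) ^ cs.length + listPotential cs

theorem listPotential_append_lt {cs cs' : List (Finset (Fin n))} (hl : cs.length = cs'.length)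
    (h : listPotential cs < listPotential cs') (pre : List (Finset (Fin n))) :
    listPotential (pre ++ cs) < listPotential (pre ++ cs') := by
  induction pre with
  | nil => exact h
  | cons S pre ih =>
    simp only [List.cons_append, listPotential, List.length_append, hl]
    omega

theorem listPotential_lt {S S' U U' : Finset (Fin n)} (h : potential U < potential S)
    (pre post : List (Finset (Fin n))) :
    listPotential (pre ++ U :: U' :: post) < listPotential (pre ++ S :: S' :: post) := by
  refine listPotential_append_lt (by simp) ?_ pre
  simp only [listPotential, List.length_cons]
  set M := (n + 1) * (n * n + 1)
  have h1 : (potential U + 1) * M ^ (post.length + 1) ≤ potential S * M ^ (post.length + 1) :=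
    Nat.mul_le_mul_right _ h
  have h2 : potential U' * M ^ post.length < M ^ (post.length + 1) := by
    rw [pow_succ, mul_comm]
    exact Nat.mul_lt_mul_of_pos_left (potential_lt U') (pow_pos (by positivity) _)
  rw [add_mul] at h1
  omega

/-- As `Std` is transitive, a violation already occurs between neighbours. -/
theorem exists_not_std {cs : List (Finset (Fin n))} (h : ¬ cs.Pairwise Std) :
    ∃ pre S S' post, cs = pre ++ S :: S' :: post ∧ ¬ Std S S' := by
  induction cs with
  | nil => exact absurd List.Pairwise.nil h
  | cons S cs ih =>
    by_cases hcs : cs.Pairwise Std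
    · rcases cs with _ | ⟨S', cs⟩
      · exact absurd (List.pairwise_singleton _ _) h
      · refine ⟨[], S, S', cs, rfl, fun hS => h (List.pairwise_cons.2 ⟨?_, hcs⟩)⟩
        intro U hU
        rcases List.mem_cons.1 hU with rfl | hU
        · exact hS
        · exact hS.trans ((List.pairwise_cons.1 hcs).1 U hU)
    · obtain ⟨pre, U, U', post, rfl, hU⟩ := ih hcs
      exact ⟨S :: pre, U, U', post, rfl, hU⟩

/-- Induction on `listPotential`: straightening an adjacent nonstandard pair lowers it. Columns may
become empty on the way, which keeps the length of the list constant. -/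
theorem columnsProd_mem (hb : ∀ i j k, Commute (anticomm (b i) (b j)) (b k)) (N : Submodule ℂ A)
    (hN : ∀ cs : List (Finset (Fin n)), cs.Pairwise Std → columnsProd b cs ∈ N) (m : ℕ) :
    ∀ cs, listPotential cs = m → columnsProd b cs ∈ N := by
  induction m using Nat.strong_induction_on with
  | _ m ih =>
    rintro cs rfl
    by_cases h : cs.Pairwise Std
    · exact hN cs h
    obtain ⟨pre, S, S', post, rfl, hS⟩ := exists_not_std h
    have e : ∀ V V' : Finset (Fin n), columnsProd b (pre ++ V :: V' :: post) =
        (LinearMap.mulRight ℂ (columnsProd b pre) ∘ₗ LinearMap.mulLeft ℂ (columnsProd b post))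
          (columnSet b V' * columnSet b V) := by
      intro V V'
      simp [columnsProd_append, columnsProd_cons, mul_assoc]
    rw [e]
    have h1 := columnSet_mul_columnSet_mem b hb hS
    have h2 : Submodule.span ℂ {x | ∃ U U' : Finset (Fin n),
      (S.card < U.card ∨ (U.card = S.card ∧ ∑ i ∈ U, (i : ℕ) < ∑ i ∈ S, (i : ℕ))) ∧
        x = columnSet b U' * columnSet b U} ≤ N.comap (LinearMap.mulRight ℂ (columnsProd b pre) ∘ₗ
          LinearMap.mulLeft ℂ (columnsProd b post)) := by
      rw [Submodule.span_le]
      rintro _ ⟨U, U', hU, rfl⟩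
      rw [SetLike.mem_coe, Submodule.mem_comap, ← e]
      exact ih _ (listPotential_lt (potential_lt_potential hU) pre post) _ rfl
    exact h2 h1

end Straightening

/-! ### Semistandard tableaux from lists of columns. -/

section Tableaux

variable {n : ℕ}

theorem std_getD {cs : List (Finset (Fin n))} (h : cs.Pairwise Std) {l l' : ℕ} (hl : l ≤ l') :
    Std (cs.getD l ∅) (cs.getD l' ∅) := by
  rcases hl.eq_or_lt with rfl | hl
  · exact fun x => le_rfl
  by_cases hl' : l' < cs.length
  · rw [List.getD_eq_getElem _ _ hl', List.getD_eq_getElem _ _ (hl.trans hl')]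
    exact List.pairwise_iff_getElem.1 h l l' _ _ hl
  · rw [List.getD_eq_default (hn := not_lt.1 hl')]
    intro x
    simp

/-- The Young diagram with given columns. -/
def shapeOfList (cs : List (Finset (Fin n))) (h : cs.Pairwise Std) : YoungDiagram where
  cells := (Finset.range n ×ˢ Finset.range cs.length).filter fun c => c.1 < (cs.getD c.2 ∅).card
  isLowerSet := by
    rintro ⟨r, l⟩ ⟨r', l'⟩ hle hmem
    rw [Finset.mem_coe, Finset.mem_filter, Finset.mem_product, Finset.mem_range, Finset.mem_range]
      at hmem ⊢
    obtain ⟨hr, hl⟩ := Prod.mk_le_mk.1 hle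
    obtain ⟨hr', -⟩ := (std_getD h hl).orderEmbOfFin_le hmem.2
    exact ⟨⟨hr.trans_lt hmem.1.1, hl.trans_lt hmem.1.2⟩, hr.trans_lt hr'⟩

theorem mem_shapeOfList {cs : List (Finset (Fin n))} (h : cs.Pairwise Std) {r l : ℕ} :
    (r, l) ∈ shapeOfList cs h ↔ r < (cs.getD l ∅).card := by
  constructor
  · intro hmem
    exact (Finset.mem_filter.1 hmem).2
  · intro hr
    refine Finset.mem_filter.2 ⟨?_, hr⟩
    rw [Finset.mem_product, Finset.mem_range, Finset.mem_range]
    refine ⟨hr.trans_le (card_finset_fin_le _), ?_⟩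
    by_contra hl
    rw [List.getD_eq_default (hn := not_lt.1 hl)] at hr
    simp at hr

/-- The semistandard tableau with given columns. -/
def tableauOfList (cs : List (Finset (Fin n))) (h : cs.Pairwise Std) : Tableau n where
  shape := shapeOfList cs h
  filling :=
    { entry := fun r l => if hr : r < (cs.getD l ∅).card then
        ((cs.getD l ∅).orderEmbOfFin rfl ⟨r, hr⟩ : ℕ) else 0
      row_weak' := by
        intro r l l' hl hmem
        rw [mem_shapeOfList] at hmem
        obtain ⟨hr, hle⟩ := (std_getD h hl.le).orderEmbOfFin_le hmem
        rw [dif_pos hmem, dif_pos hr]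
        exact hle
      col_strict' := by
        intro r r' l hr hmem
        rw [mem_shapeOfList] at hmem
        have hr' : r < (cs.getD l ∅).card := hr.trans hmem
        rw [dif_pos hmem, dif_pos hr']
        exact ((cs.getD l ∅).orderEmbOfFin rfl).strictMono hr
      zeros' := by
        intro r l hmem
        rw [mem_shapeOfList] at hmem
        exact dif_neg hmem }
  entry_lt := by
    intro r l hmem
    rw [mem_shapeOfList] at hmem
    change (if hr : r < (cs.getD l ∅).card then
        ((cs.getD l ∅).orderEmbOfFin rfl ⟨r, hr⟩ : ℕ) else 0) < n
    rw [dif_pos hmem]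
    exact Fin.is_lt _

theorem mem_tableauOfList_shape {cs : List (Finset (Fin n))} (h : cs.Pairwise Std) {r l : ℕ} :
    (r, l) ∈ (tableauOfList cs h).shape ↔ r < (cs.getD l ∅).card :=
  mem_shapeOfList h

theorem colLen_tableauOfList {cs : List (Finset (Fin n))} (h : cs.Pairwise Std) (l : ℕ) :
    (tableauOfList cs h).shape.colLen l = (cs.getD l ∅).card := by
  refine eq_of_forall_lt_iff fun r => ?_
  rw [← YoungDiagram.mem_iff_lt_colLen, mem_tableauOfList_shape]

variable {A : Type*} [Ring A] (b : Fin n → A)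

/-- Empty columns are excluded because they are invisible in the shape, whose number of columns
would then be smaller than the length of the list. -/
theorem tableauOp_tableauOfList {cs : List (Finset (Fin n))} (h : cs.Pairwise Std)
    (hne : ∀ S ∈ cs, S ≠ ∅) : tableauOp b (tableauOfList cs h) = columnsProd b cs := by
  have hnum : (tableauOfList cs h).numCols = cs.length := by
    refine eq_of_forall_lt_iff fun l => ?_
    rw [Tableau.numCols, ← YoungDiagram.mem_iff_lt_rowLen, mem_tableauOfList_shape]
    constructor
    · intro h0
      by_contra hl
      rw [List.getD_eq_default (hn := not_lt.1 hl)] at h0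
      simp at h0
    · intro hl
      rw [List.getD_eq_getElem _ _ hl, Finset.card_pos, Finset.nonempty_iff_ne_empty]
      exact hne _ (List.getElem_mem hl)
  unfold tableauOp columnsProd
  congr 2
  refine List.ext_getElem (by simp [hnum]) fun l h1 h2 => ?_
  rw [List.length_map] at h2
  rw [List.getElem_ofFn, List.getElem_map, columnSet]
  have h3 : cs.getD l ∅ = cs[l] := List.getD_eq_getElem _ _ h2
  rw [← h3]
  refine columnOp_congr b (colLen_tableauOfList h l) fun r => ?_
  apply Fin.ext
  exact dif_pos (colLen_tableauOfList h l ▸ r.2)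

theorem columnsProd_filter_ne_empty (cs : List (Finset (Fin n))) :
    columnsProd b (cs.filter (· ≠ ∅)) = columnsProd b cs := by
  induction cs with
  | nil => rfl
  | cons S cs ih =>
    by_cases hS : S = ∅
    · rw [List.filter_cons_of_neg (by simpa using hS), ih, columnsProd_cons, hS, columnSet_empty,
        mul_one]
    · rw [List.filter_cons_of_pos (by simpa using hS), columnsProd_cons, columnsProd_cons, ih]

theorem columnSet_singleton (i : Fin n) : columnSet b {i} = b i := by
  have h : columnSet b {i} = columnOp b (fun _ : Fin 1 => i) :=
    columnOp_congr b (Finset.card_singleton i) fun r => Finset.mem_singleton.1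
      (Finset.orderEmbOfFin_mem _ _ _)
  rw [h, columnOp, Fintype.sum_unique]
  simp

/-- The tableau operators span an algebra generated by elements whose anticommutators
are central. -/
theorem span_tableauOp_eq_top [Algebra ℂ A]
    (hb : ∀ i j k, Commute (anticomm (b i) (b j)) (b k))
    (hgen : Algebra.adjoin ℂ (Set.range b) = ⊤) :
    Submodule.span ℂ (Set.range fun T : Tableau n => tableauOp b T) = ⊤ := by
  have h1 : ∀ cs, columnsProd b cs ∈
      Submodule.span ℂ (Set.range fun T : Tableau n => tableauOp b T) := by
    intro cs
    refine columnsProd_mem b hb _ ?_ _ cs rfl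
    intro cs hcs
    rw [← columnsProd_filter_ne_empty, ← tableauOp_tableauOfList b (hcs.filter _)]
    · exact Submodule.subset_span ⟨_, rfl⟩
    · intro S hS
      simpa using (List.mem_filter.1 hS).2
  rw [eq_top_iff, ← Algebra.top_toSubmodule, ← hgen, Algebra.adjoin_eq_span, Submodule.span_le]
  intro x hx
  obtain ⟨w, hw, rfl⟩ := Submonoid.exists_list_of_mem_closure hx
  have h2 : ∃ cs, columnsProd b cs = w.prod := by
    clear hx
    induction w with
    | nil => exact ⟨[], rfl⟩
    | cons y w ih =>
      obtain ⟨cs, hcs⟩ := ih fun z hz => hw z (List.mem_cons_of_mem _ hz)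
      obtain ⟨i, rfl⟩ := hw y List.mem_cons_self
      refine ⟨cs ++ [{i}], ?_⟩
      rw [columnsProd_append, hcs, columnsProd_cons, columnSet_singleton, List.prod_cons]
      simp [columnsProd]
  obtain ⟨cs, hcs⟩ := h2
  rw [← hcs]
  exact h1 cs

end Tableaux

/-! ### From the action on creation operators to the triple relations. -/

section GlAction

variable {n : ℕ}

/-- The super Jacobi identity for three odd elements, which derives the relation for `[{B^+, B^+},
B^-]` from the one for `[{B^+, B^-}, B^+]`. -/
theorem trip_jacobi {R : Type*} [Ring R] (x y z : R) :
    anticomm x y * z - z * anticomm x y =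
      (x * anticomm y z - anticomm y z * x) + (y * anticomm x z - anticomm x z * y) := by
  unfold anticomm
  noncomm_ring

/-- Twice the Kronecker symbol. -/
def krTwo (i j : Fin n) : ℂ := if i = j then 2 else 0

theorem krTwo_comm (i j : Fin n) : krTwo i j = krTwo j i := by
  simp only [krTwo, eq_comm]

variable {R : Type*} [Ring R] [Algebra ℂ R] {L D : Fin n → R} {G : Fin n → Fin n → R}

/-- The two sides of the `gl` relation have the same commutator with every creation operator. On a
space generated from one vector by the `L m`, it then suffices to compare them on that vector. The
steps for `G`, `D` and for three lowering operators below serve the same purpose, with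
anticommutators as these elements are odd. -/
theorem gl_comm_step (hG : ∀ i j k, G i j * L k = L k * G i j + krTwo j k • L i)
    (i j k l m : Fin n) :
    G i j * G k l * L m - L m * (G i j * G k l) =
      (G k l * G i j + krTwo j k • G i l - krTwo i l • G k j) * L m -
        L m * (G k l * G i j + krTwo j k • G i l - krTwo i l • G k j) := by
  have e1 : G i j * G k l * L m = L m * G i j * G k l + krTwo j m • (L i * G k l) +
      krTwo l m • (L k * G i j + krTwo j k • L i) := by
    rw [mul_assoc, hG, mul_add, ← mul_assoc, hG, mul_smul_comm, hG, add_mul, smul_mul_assoc]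
  have e2 : G k l * G i j * L m = L m * G k l * G i j + krTwo l m • (L k * G i j) +
      krTwo j m • (L i * G k l + krTwo i l • L k) := by
    rw [mul_assoc, hG, mul_add, ← mul_assoc, hG, mul_smul_comm, hG, add_mul, smul_mul_assoc,
      krTwo_comm l i]
  rw [sub_mul, add_mul, e1, e2, smul_mul_assoc, smul_mul_assoc, hG, hG]
  simp only [mul_sub, mul_add, mul_smul_comm, ← mul_assoc]
  module

theorem gl_lower_step (hG : ∀ i j k, G i j * L k = L k * G i j + krTwo j k • L i)
    (hD : ∀ l k, D l * L k = G k l - L k * D l) {i j l k : Fin n}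
    (h : G i j * G k l = G k l * G i j + krTwo j k • G i l - krTwo i l • G k j) :
    G i j * D l * L k + L k * (G i j * D l) =
      (D l * G i j - krTwo i l • D j) * L k + L k * (D l * G i j - krTwo i l • D j) := by
  have e1 : G i j * D l * L k = G i j * G k l - (L k * G i j + krTwo j k • L i) * D l := by
    rw [mul_assoc, hD, mul_sub, ← mul_assoc, hG]
  have e2 : D l * G i j * L k = (G k l - L k * D l) * G i j + krTwo j k • (G i l - L i * D l) := by
    rw [mul_assoc, hG, mul_add, ← mul_assoc, hD, mul_smul_comm, hD]
  rw [sub_mul, e1, e2, smul_mul_assoc, hD, h]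
  simp only [mul_sub, sub_mul, add_mul, smul_mul_assoc, mul_smul_comm, ← mul_assoc]
  module

theorem anticomm_lower_mul (hD : ∀ l k, D l * L k = G k l - L k * D l)
    (hGD : ∀ i j l, G i j * D l = D l * G i j - krTwo i l • D j) (i j k : Fin n) :
    anticomm (D i) (D j) * L k = L k * anticomm (D i) (D j) + krTwo k i • D j +
      krTwo k j • D i := by
  have e : ∀ i j, D i * D j * L k = D i * G k j - (G k i - L k * D i) * D j := by
    intro i j
    rw [mul_assoc, hD, mul_sub, ← mul_assoc, hD]
  rw [anticomm, add_mul, e, e]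
  simp only [mul_add, sub_mul, hGD, mul_assoc]
  module

theorem anticomm_lower_comm_step (hD : ∀ l k, D l * L k = G k l - L k * D l)
    (hGD : ∀ i j l, G i j * D l = D l * G i j - krTwo i l • D j) (i j l k : Fin n) :
    anticomm (D i) (D j) * D l * L k + L k * (anticomm (D i) (D j) * D l) =
      D l * anticomm (D i) (D j) * L k + L k * (D l * anticomm (D i) (D j)) := by
  have h1 := anticomm_lower_mul hD hGD i j k
  have e : ∀ i j, D i * D j * G k l = G k l * (D i * D j) + krTwo k i • (D l * D j) +
      krTwo k j • (D i * D l) := by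
    intro i j
    have e1 := hGD k l i
    have e2 := hGD k l j
    rw [mul_assoc, eq_add_of_sub_eq e2.symm, mul_add, ← mul_assoc, eq_add_of_sub_eq e1.symm]
    simp only [add_mul, smul_mul_assoc, mul_smul_comm, mul_assoc]
  have h4 : anticomm (D i) (D j) * G k l = G k l * anticomm (D i) (D j) +
      krTwo k i • anticomm (D l) (D j) + krTwo k j • anticomm (D i) (D l) := by
    unfold anticomm
    rw [add_mul, e, e, mul_add]
    module
  rw [mul_assoc (anticomm _ _), hD, mul_sub, h4, ← mul_assoc, h1, mul_assoc (D l), h1]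
  unfold anticomm
  simp only [mul_add, sub_mul, add_mul, mul_smul_comm, smul_mul_assoc, ← mul_assoc, hD]
  module

theorem triple_of_action (hL : ∀ i j k, Commute (anticomm (L i) (L j)) (L k))
    (hG : ∀ i j k, G i j * L k = L k * G i j + krTwo j k • L i)
    (hD : ∀ l k, D l * L k = G k l - L k * D l)
    (hGD : ∀ i j l, G i j * D l = D l * G i j - krTwo i l • D j)
    (hDDD : ∀ i j l, anticomm (D i) (D j) * D l = D l * anticomm (D i) (D j))
    (ξ η ε : ℤˣ) (i j l : Fin n) :
    tripleLHS (fun ξ : ℤˣ => if ξ = 1 then L else D) ξ η ε i j l =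
      tripleRHS (fun ξ : ℤˣ => if ξ = 1 then L else D) ξ η ε i j l := by
  have hGLD : ∀ i j, anticomm (L i) (D j) = G i j := by
    intro i j
    rw [anticomm, hD]
    abel
  have hGDL : ∀ i j, anticomm (D j) (L i) = G i j := by
    intro i j
    rw [anticomm, hD]
    abel
  have hkr : ∀ (i l : Fin n) (T : R), (if i = l then (2 : ℤ) else 0) • T = krTwo i l • T := by
    intro i l T
    unfold krTwo
    split_ifs
    · rw [← Int.cast_smul_eq_zsmul ℂ]
      norm_num
    · simp
  have hkr' : ∀ (i l : Fin n) (T : R), (if i = l then (-2 : ℤ) else 0) • T = -(krTwo i l • T) := by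
    intro i l T
    rw [← hkr, ← neg_smul]
    split_ifs <;> simp
  have hm : (-1 : ℤˣ) ≠ 1 := by decide
  have hs : ((1 : ℤ) - -1) = 2 := by norm_num
  have hs' : ((-1 : ℤ) - 1) = -2 := by norm_num
  unfold tripleLHS tripleRHS
  rcases Int.units_eq_one_or ξ with rfl | rfl <;> rcases Int.units_eq_one_or η with rfl | rfl <;>
    rcases Int.units_eq_one_or ε with rfl | rfl <;>
    simp only [if_pos, if_neg hm, hGLD, hGDL, Units.val_one, Units.val_neg, sub_self, ite_self,
      zero_smul, add_zero, zero_add, hs, hs', hkr, hkr']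
  · rw [(hL i j l).eq, sub_self]
  · rw [trip_jacobi, hGLD, hGLD, hG, hG, krTwo_comm l j, krTwo_comm l i]
    module
  · rw [hG]
    module
  · rw [hGD]
    module
  · rw [hG]
    module
  · rw [hGD]
    module
  · rw [anticomm_lower_mul hD hGD, krTwo_comm l j, krTwo_comm l i]
    module
  · rw [hDDD, sub_self]

end GlAction

/-! ### The algebra of creation operators and the action of `osp(1|2n)` on it. -/

section ParaAlg

/-- The anticommutators of the generators are central. -/
inductive ParaRel (n : ℕ) : FreeAlgebra ℂ (Fin n) → FreeAlgebra ℂ (Fin n) → Prop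
  | comm (i j k : Fin n) : ParaRel n
      (anticomm (FreeAlgebra.ι ℂ i) (FreeAlgebra.ι ℂ j) * FreeAlgebra.ι ℂ k)
      (FreeAlgebra.ι ℂ k * anticomm (FreeAlgebra.ι ℂ i) (FreeAlgebra.ι ℂ j))

/-- The algebra with generators `b_1, …, b_n` and relations `[{b_i, b_j}, b_k] = 0`, which is the
enveloping algebra of the superalgebra generated by the creation operators. -/
abbrev ParaAlg (n : ℕ) : Type := RingQuot (ParaRel n)

variable {n : ℕ}

/-- The generators of `ParaAlg n`. -/
def pb (i : Fin n) : ParaAlg n := RingQuot.mkAlgHom ℂ (ParaRel n) (FreeAlgebra.ι ℂ i)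

theorem commute_pb (i j k : Fin n) : Commute (anticomm (pb i) (pb j)) (pb k) := by
  have h := RingQuot.mkAlgHom_rel ℂ (ParaRel.comm i j k)
  simp only [anticomm, map_mul, map_add] at h
  exact h

/-- The universal property of `ParaAlg n`. -/
def paraLift {R : Type*} [Ring R] [Algebra ℂ R] (b : Fin n → R)
    (hb : ∀ i j k, Commute (anticomm (b i) (b j)) (b k)) : ParaAlg n →ₐ[ℂ] R :=
  RingQuot.liftAlgHom ℂ ⟨FreeAlgebra.lift ℂ b, by
    rintro _ _ ⟨i, j, k⟩
    simpa only [anticomm, map_mul, map_add, FreeAlgebra.lift_ι_apply] using (hb i j k).eq⟩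

theorem paraLift_pb {R : Type*} [Ring R] [Algebra ℂ R] (b : Fin n → R)
    (hb : ∀ i j k, Commute (anticomm (b i) (b j)) (b k)) (i : Fin n) :
    paraLift b hb (pb i) = b i := by
  simp [paraLift, pb]

theorem adjoin_range_mkAlgHom_ι {T : Type*} (r : FreeAlgebra ℂ T → FreeAlgebra ℂ T → Prop) :
    Algebra.adjoin ℂ (Set.range fun t => RingQuot.mkAlgHom ℂ r (FreeAlgebra.ι ℂ t)) = ⊤ := by
  have h : (Set.range fun t => RingQuot.mkAlgHom ℂ r (FreeAlgebra.ι ℂ t)) =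
      RingQuot.mkAlgHom ℂ r '' Set.range (FreeAlgebra.ι ℂ) := by
    rw [← Set.range_comp]
    rfl
  rw [h, ← AlgHom.map_adjoin, FreeAlgebra.adjoin_range_ι, Algebra.map_top, AlgHom.range_eq_top]
  exact RingQuot.mkAlgHom_surjective ℂ r

theorem adjoin_range_pb : Algebra.adjoin ℂ (Set.range (pb : Fin n → ParaAlg n)) = ⊤ :=
  adjoin_range_mkAlgHom_ι _

theorem mem_of_left_stable {R : Type*} [Ring R] [Algebra ℂ R] {s : Set R}
    (hs : Algebra.adjoin ℂ s = ⊤) (N : Submodule ℂ R) (h1 : (1 : R) ∈ N)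
    (hN : ∀ a ∈ s, ∀ w ∈ N, a * w ∈ N) (x : R) : x ∈ N := by
  have h : ∀ w ∈ N, x * w ∈ N := by
    have hx : x ∈ Algebra.adjoin ℂ s := hs ▸ Algebra.mem_top
    induction hx using Algebra.adjoin_induction with
    | mem a ha => exact hN a ha
    | algebraMap z =>
      intro w hw
      rw [← Algebra.smul_def]
      exact N.smul_mem z hw
    | add x y _ _ hx hy =>
      intro w hw
      rw [add_mul]
      exact N.add_mem (hx w hw) (hy w hw)
    | mul x y _ _ hx hy =>
      intro w hw
      rw [mul_assoc]
      exact hx _ (hy w hw)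
  simpa using h 1 h1

/-- Left multiplication by a generator. -/
def lmulPb (i : Fin n) : Module.End ℂ (ParaAlg n) := LinearMap.mulLeft ℂ (pb i)

theorem lmulPb_apply (i : Fin n) (w : ParaAlg n) : lmulPb i w = pb i * w := rfl

theorem commute_lmulPb (i j k : Fin n) : Commute (anticomm (lmulPb i) (lmulPb j)) (lmulPb k) := by
  refine LinearMap.ext fun w => ?_
  have h := congrArg (· * w) (commute_pb i j k).eq
  simpa [anticomm, lmulPb, mul_assoc, add_mul, mul_add] using h

theorem end_ext {T : Module.End ℂ (ParaAlg n)} (h1 : T 1 = 0)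
    (hT : ∀ k w, T w = 0 → T (pb k * w) = 0) : T = 0 := by
  refine LinearMap.ext fun w => ?_
  refine mem_of_left_stable adjoin_range_pb (LinearMap.ker T) h1 ?_ w
  rintro _ ⟨k, rfl⟩ w hw
  exact hT k w hw

/-- The vanishing of `S - T` propagates from `1` through left multiplications by the generators, and
these reach all of `ParaAlg n`. -/
theorem end_ext_comm {S T : Module.End ℂ (ParaAlg n)} (h1 : S 1 = T 1)
    (hT : ∀ k, S * lmulPb k - lmulPb k * S = T * lmulPb k - lmulPb k * T) : S = T := by
  rw [← sub_eq_zero]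
  refine end_ext (by rw [LinearMap.sub_apply, h1, sub_self]) fun k w hw => ?_
  have h := LinearMap.congr_fun (hT k) w
  simp only [LinearMap.sub_apply, Module.End.mul_apply, lmulPb_apply] at h hw
  rw [LinearMap.sub_apply, ← sub_eq_zero.2 h, sub_eq_zero.1 hw]
  abel

theorem end_ext_anticomm {S T : Module.End ℂ (ParaAlg n)} (h1 : S 1 = T 1)
    (hT : ∀ k, S * lmulPb k + lmulPb k * S = T * lmulPb k + lmulPb k * T) : S = T := by
  rw [← sub_eq_zero]
  refine end_ext (by rw [LinearMap.sub_apply, h1, sub_self]) fun k w hw => ?_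
  have h := LinearMap.congr_fun (hT k) w
  simp only [LinearMap.sub_apply, LinearMap.add_apply, Module.End.mul_apply, lmulPb_apply] at h hw
  rw [LinearMap.sub_apply, ← sub_eq_zero.2 h, sub_eq_zero.1 hw]
  abel

/-- An operator on `ParaAlg n` may be prescribed by its twisted commutators with the
generators, if these are compatible with the relations. -/
theorem exists_twisted (ε : ℂ) (hε : ε * ε = 1) (C : Fin n → Module.End ℂ (ParaAlg n))
    (hC : ∀ i j k,
      (C i * lmulPb j + C j * lmulPb i + ε • (lmulPb i * C j + lmulPb j * C i)) * lmulPb k +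
          anticomm (lmulPb i) (lmulPb j) * C k =
        C k * anticomm (lmulPb i) (lmulPb j) + ε • (lmulPb k *
          (C i * lmulPb j + C j * lmulPb i + ε • (lmulPb i * C j + lmulPb j * C i)))) :
    ∃ T : Module.End ℂ (ParaAlg n), T 1 = 0 ∧
      ∀ j, T * lmulPb j = ε • (lmulPb j * T) + C j := by
  -- The corner entry of a product of such triangular matrices obeys a twisted Leibniz rule. The
  -- relations of `ParaAlg n` hold on the diagonal because `ε * ε = 1`, and in the corner they
  -- amount to `hC`; hence `M` extends to all of `ParaAlg n`, and `T` is read off from the corner.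
  let M : Fin n → Matrix (Fin 2) (Fin 2) (Module.End ℂ (ParaAlg n)) := fun j =>
    !![lmulPb j, 0; C j, ε • lmulPb j]
  have hM : ∀ i j k, Commute (anticomm (M i) (M j)) (M k) := by
    intro i j k
    have h1 := (commute_lmulPb i j k).eq
    have e : anticomm (M i) (M j) = !![anticomm (lmulPb i) (lmulPb j), 0;
        C i * lmulPb j + C j * lmulPb i + ε • (lmulPb i * C j + lmulPb j * C i),
        anticomm (lmulPb i) (lmulPb j)] := by
      have e1 : ∀ i j : Fin n, ε • lmulPb i * ε • lmulPb j = lmulPb i * lmulPb j := fun i j => by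
        rw [smul_mul_assoc, mul_smul_comm, smul_smul, hε, one_smul]
      simp only [M, anticomm, Matrix.mul_fin_two, e1, smul_mul_assoc]
      ext a c : 2
      fin_cases a <;> fin_cases c <;> simp [smul_add, add_add_add_comm]
    rw [Commute, SemiconjBy, e]
    simp only [M, Matrix.mul_fin_two]
    have h2 : anticomm (lmulPb i) (lmulPb j) * (ε • lmulPb k) =
        ε • (lmulPb k * anticomm (lmulPb i) (lmulPb j)) := by rw [mul_smul_comm, h1]
    rw [hC i j k, h1, h2, smul_mul_assoc, smul_mul_assoc]
    simp
  let Φ := paraLift M hM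
  have hΦ : ∀ j w, Φ (pb j * w) = M j * Φ w := by
    intro j w
    rw [map_mul, paraLift_pb]
  have h00 : ∀ w x, Φ w 0 0 x = w * x := by
    intro w x
    let N : Submodule ℂ (ParaAlg n) := 
      { carrier := {w | ∀ x, Φ w 0 0 x = w * x}
        add_mem' := by
          intro a b ha hb x
          rw [map_add, Matrix.add_apply, LinearMap.add_apply, ha, hb, add_mul]
        zero_mem' := by
          intro x
          simp
        smul_mem' := by
          intro c a ha x
          rw [map_smul, Matrix.smul_apply, LinearMap.smul_apply, ha, smul_mul_assoc] }
    refine mem_of_left_stable adjoin_range_pb N ?_ ?_ w x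
    · intro x
      simp
    · rintro _ ⟨j, rfl⟩ w hw x
      rw [hΦ, Matrix.mul_apply, Fin.sum_univ_two]
      simp only [M, Matrix.of_apply, Matrix.cons_val', Matrix.cons_val_zero, Matrix.cons_val_one,
        zero_mul, add_zero, Module.End.mul_apply, hw x, lmulPb_apply, mul_assoc]
  let T : Module.End ℂ (ParaAlg n) :=
    { toFun := fun w => Φ w 1 0 1
      map_add' := by
        intro x y
        rw [map_add, Matrix.add_apply, LinearMap.add_apply]
      map_smul' := by
        intro c x
        rw [map_smul, Matrix.smul_apply, LinearMap.smul_apply, RingHom.id_apply] }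
  refine ⟨T, ?_, fun j => LinearMap.ext fun w => ?_⟩
  · change Φ 1 1 0 1 = _
    simp
  · change Φ (pb j * w) 1 0 1 = ε • (pb j * Φ w 1 0 1) + C j w
    rw [hΦ, Matrix.mul_apply, Fin.sum_univ_two]
    simp [M, h00, lmulPb_apply, add_comm]

/-- Take the derivation with `b_k ↦ 2 δ_{jk} b_i`, and add the scalar `p / 2 * krTwo i j = p
δ_{ij}`: it does not affect commutators and gives the vacuum `1` its weight. -/
theorem exists_gl (p : ℂ) : ∃ G : Fin n → Fin n → Module.End ℂ (ParaAlg n),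
    (∀ i j, G i j 1 = (p / 2 * krTwo i j) • 1) ∧
      ∀ i j k, G i j * lmulPb k = lmulPb k * G i j + krTwo j k • lmulPb i := by
  have h : ∀ i j : Fin n, ∃ T : Module.End ℂ (ParaAlg n), T 1 = 0 ∧
      ∀ k, T * lmulPb k = (1 : ℂ) • (lmulPb k * T) + krTwo j k • lmulPb i := by
    intro i j
    refine exists_twisted 1 (one_mul 1) _ fun a c k => ?_
    have e : krTwo j a • lmulPb i * lmulPb c + krTwo j c • lmulPb i * lmulPb a +
        (1 : ℂ) • (lmulPb a * krTwo j c • lmulPb i + lmulPb c * krTwo j a • lmulPb i) =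
        krTwo j a • anticomm (lmulPb i) (lmulPb c) + krTwo j c • anticomm (lmulPb i) (lmulPb a) := by
      unfold anticomm
      simp only [smul_mul_assoc, mul_smul_comm]
      module
    rw [e, add_mul, mul_add, smul_mul_assoc, smul_mul_assoc, mul_smul_comm, mul_smul_comm,
      mul_smul_comm, smul_mul_assoc, (commute_lmulPb i c k).eq, (commute_lmulPb i a k).eq,
      (commute_lmulPb a c i).eq]
    module
  choose E hE1 hE using h
  refine ⟨fun i j => E i j + (p / 2 * krTwo i j) • 1, fun i j => ?_, fun i j k => ?_⟩
  · rw [LinearMap.add_apply, hE1, zero_add, LinearMap.smul_apply, Module.End.one_apply]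
  · rw [add_mul, hE, mul_add, smul_mul_assoc, mul_smul_comm, one_mul, mul_one]
    module

variable {G : Fin n → Fin n → Module.End ℂ (ParaAlg n)}

theorem gl_anticomm (hG : ∀ i j k, G i j * lmulPb k = lmulPb k * G i j + krTwo j k • lmulPb i)
    (i j k l : Fin n) :
    G k l * anticomm (lmulPb i) (lmulPb j) = anticomm (lmulPb i) (lmulPb j) * G k l +
      krTwo l i • anticomm (lmulPb k) (lmulPb j) + krTwo l j • anticomm (lmulPb i) (lmulPb k) := by
  have h1 := hG k l i
  have h2 := hG k l j
  unfold anticomm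
  rw [mul_add, ← mul_assoc, ← mul_assoc, h1, h2, add_mul, add_mul, mul_assoc, mul_assoc _ (G k l),
    h1, h2]
  simp only [mul_add, add_mul, smul_mul_assoc, mul_smul_comm, mul_assoc]
  module

/-- The case `ε = -1` of `exists_twisted`: a skew derivation with `G k l` as its value on `b_k`. The
terms containing `G` cancel in the compatibility condition up to Kronecker symbols, which match the
action of `G` on the anticommutators. -/
theorem exists_lower
    (hG : ∀ i j k, G i j * lmulPb k = lmulPb k * G i j + krTwo j k • lmulPb i) :
    ∃ D : Fin n → Module.End ℂ (ParaAlg n), (∀ l, D l 1 = 0) ∧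
      ∀ l k, D l * lmulPb k = G k l - lmulPb k * D l := by
  have h : ∀ l : Fin n, ∃ T : Module.End ℂ (ParaAlg n), T 1 = 0 ∧
      ∀ k, T * lmulPb k = (-1 : ℂ) • (lmulPb k * T) + G k l := by
    intro l
    refine exists_twisted (-1) (by norm_num) _ fun a c k => ?_
    have e : G a l * lmulPb c + G c l * lmulPb a + (-1 : ℂ) • (lmulPb a * G c l + lmulPb c * G a l) =
        krTwo l c • lmulPb a + krTwo l a • lmulPb c := by
      rw [hG, hG]
      module
    rw [e, gl_anticomm hG]
    unfold anticomm
    simp only [mul_add, add_mul, smul_mul_assoc, mul_smul_comm]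
    module
  choose D hD1 hD using h
  refine ⟨D, hD1, fun l k => ?_⟩
  rw [hD]
  module

/-- The action of `osp(1|2n)` on `ParaAlg n` which turns it into the induced module. -/
theorem exists_action (n : ℕ) (p : ℂ) : ∃ ρ : UOsp n →ₐ[ℂ] Module.End ℂ (ParaAlg n),
    (∀ i, ρ (Bp i) = lmulPb i) ∧ (∀ i, ρ (Bm i) 1 = 0) ∧
      ∀ i j, ρ (anticomm (Bp i) (Bm j)) 1 = (if i = j then p else 0) • 1 := by
  obtain ⟨G, hG1, hG⟩ := exists_gl (n := n) p
  obtain ⟨D, hD1, hD⟩ := exists_lower hG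
  -- The remaining relations follow one from another, each by comparing both sides at `1` and their
  -- commutators or anticommutators with the creation operators.
  have hGG : ∀ i j k l,
      G i j * G k l = G k l * G i j + krTwo j k • G i l - krTwo i l • G k j := by
    intro i j k l
    refine end_ext_comm ?_ (gl_comm_step (R := Module.End ℂ (ParaAlg n)) (L := lmulPb) hG i j k l)
    simp only [LinearMap.sub_apply, LinearMap.add_apply, Module.End.mul_apply, hG1, map_smul,
      LinearMap.smul_apply]
    rw [krTwo_comm k j]
    module
  have hGD : ∀ i j l, G i j * D l = D l * G i j - krTwo i l • D j := by
    intro i j l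
    refine end_ext_anticomm ?_ fun k => gl_lower_step (R := Module.End ℂ (ParaAlg n)) (L := lmulPb) hG hD (hGG i j k l)
    simp only [LinearMap.sub_apply, Module.End.mul_apply, hG1, hD1, map_smul, map_zero,
      LinearMap.smul_apply, smul_zero, sub_zero]
  have hDDD : ∀ i j l, anticomm (D i) (D j) * D l = D l * anticomm (D i) (D j) := by
    intro i j l
    refine end_ext_anticomm ?_ (anticomm_lower_comm_step (R := Module.End ℂ (ParaAlg n)) (L := lmulPb) hD hGD i j l)
    simp [anticomm, hD1]
  let B : ℤˣ → Fin n → Module.End ℂ (ParaAlg n) := fun ξ => if ξ = 1 then lmulPb else D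
  have hB1 : B 1 = lmulPb := if_pos rfl
  have hB2 : B (-1) = D := if_neg (by decide)
  refine ⟨RingQuot.liftAlgHom ℂ ⟨FreeAlgebra.lift ℂ (fun g : ℤˣ × Fin n => B g.1 g.2), ?_⟩,
    fun i => ?_, fun i => ?_, fun i j => ?_⟩
  · rintro _ _ ⟨ξ, η, ε, i, j, l⟩
    have h : tripleLHS B ξ η ε i j l = tripleRHS B ξ η ε i j l :=
      triple_of_action (R := Module.End ℂ (ParaAlg n)) (L := lmulPb) commute_lmulPb hG hD hGD hDDD ξ η ε i j l
    simp only [tripleLHS, tripleRHS, anticomm] at h ⊢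
    simpa only [map_sub, map_add, map_mul, map_zsmul, FreeAlgebra.lift_ι_apply] using h
  · simp [gen, hB1]
  · simp [gen, hB2, hD1]
  · have e : (p / 2 * krTwo i j) = if i = j then p else 0 := by
      unfold krTwo
      split_ifs <;> ring
    have h : (G i j - lmulPb i * D j) 1 = (p / 2 * krTwo i j) • 1 := by
      rw [LinearMap.sub_apply, Module.End.mul_apply, hD1, map_zero, sub_zero, hG1]
    rw [← hD, Module.End.mul_apply] at h
    rw [← e, ← h]
    simp [anticomm, gen, hB1, hB2, hD1]

end ParaAlg

/-! ### The induced module as a copy of `ParaAlg n`. -/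

section Induced

variable {n : ℕ}

theorem gen_triple (ξ η ε : ℤˣ) (i j l : Fin n) :
    tripleLHS (gen (n := n)) ξ η ε i j l = tripleRHS gen ξ η ε i j l := by
  have h := RingQuot.mkAlgHom_rel ℂ (TripleRel.triple ξ η ε i j l)
  simp only [tripleLHS, tripleRHS, anticomm, map_sub, map_add, map_mul, map_zsmul] at h
  exact h

theorem adjoin_range_gen :
    Algebra.adjoin ℂ (Set.range fun g : ℤˣ × Fin n => gen g.1 g.2) = ⊤ :=
  adjoin_range_mkAlgHom_ι _

theorem commute_Bp (i j k : Fin n) : Commute (anticomm (Bp i) (Bp j)) (Bp k) := by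
  have h := gen_triple 1 1 1 i j k
  simp only [tripleLHS, tripleRHS, sub_self, ite_self, zero_zsmul, add_zero] at h
  exact sub_eq_zero.1 h

theorem anticomm_Bp_Bm_mul_Bp (i j k : Fin n) :
    anticomm (Bp i) (Bm j) * Bp k = Bp k * anticomm (Bp i) (Bm j) + krTwo j k • Bp i := by
  have h := gen_triple 1 (-1) 1 i j k
  simp only [tripleLHS, tripleRHS, sub_self, ite_self, zero_zsmul, zero_add] at h
  rw [sub_eq_iff_eq_add'] at h
  rw [h, krTwo]
  congr 1
  split_ifs
  · rw [← Int.cast_smul_eq_zsmul ℂ]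
    norm_num [two_smul, two_mul]
  · simp

/-- The subalgebra generated by the creation operators. -/
def paraToU (n : ℕ) : ParaAlg n →ₐ[ℂ] UOsp n := paraLift Bp commute_Bp

theorem paraToU_pb (i : Fin n) : paraToU n (pb i) = Bp i := paraLift_pb _ _ i

/-- The enveloping algebra is spanned by the creation operators and the vacuum ideal. -/
theorem exists_sub_mem_vacuumIdeal (p : ℕ) (u : UOsp n) :
    ∃ a : ParaAlg n, u - paraToU n a ∈ vacuumIdeal n p := by
  let I : Submodule ℂ (UOsp n) := (vacuumIdeal n p).restrictScalars ℂ
  let N : Submodule ℂ (UOsp n) := I ⊔ LinearMap.range (paraToU n).toLinearMap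
  have hI : I ≤ N := le_sup_left
  have hpara : ∀ a, paraToU n a ∈ N := fun a =>
    (le_sup_right : LinearMap.range (paraToU n).toLinearMap ≤ N) ⟨a, rfl⟩
  have hIl : ∀ x, ∀ w ∈ I, x * w ∈ I := fun x w hw => (vacuumIdeal n p).smul_mem x hw
  have hrel : ∀ x, IsVacuumRelator n p x → x ∈ I := fun x hx => Submodule.subset_span hx
  have hleft : ∀ x : UOsp n, (∀ a, x * paraToU n a ∈ N) → ∀ w ∈ N, x * w ∈ N := by
    intro x hx w hw
    obtain ⟨y, hy, z, ⟨a, rfl⟩, rfl⟩ := Submodule.mem_sup.1 hw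
    rw [mul_add]
    exact N.add_mem (hI (hIl x y hy)) (hx a)
  have hBp : ∀ i, ∀ w ∈ N, Bp i * w ∈ N := fun i => hleft _ fun a => by
    rw [← paraToU_pb, ← map_mul]
    exact hpara _
  -- Normal ordering: `{B_i^+, B_j^-}` is moved to the right through the creation operators until it
  -- meets the ideal. Then `B_i^-` is treated alike, each exchange with a creation operator
  -- producing such an anticommutator.
  have hG : ∀ i j a, anticomm (Bp i) (Bm j) * paraToU n a ∈ N := by
    intro i j a
    let N' : Submodule ℂ (ParaAlg n) :=
      N.comap (LinearMap.mulLeft ℂ (anticomm (Bp i) (Bm j)) ∘ₗ (paraToU n).toLinearMap)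
    refine mem_of_left_stable adjoin_range_pb N' ?_ ?_ a
    · change anticomm (Bp i) (Bm j) * paraToU n 1 ∈ N
      rw [map_one, mul_one]
      have h1 := hI (hrel _ (IsVacuumRelator.mixed i j))
      rw [← sub_add_cancel (anticomm (Bp i) (Bm j))
        (algebraMap ℂ (UOsp n) (if i = j then (p : ℂ) else 0))]
      refine N.add_mem h1 ?_
      rw [← (paraToU n).commutes]
      exact hpara _
    · rintro _ ⟨k, rfl⟩ w hw
      change anticomm (Bp i) (Bm j) * paraToU n (pb k * w) ∈ N
      rw [map_mul, paraToU_pb, ← mul_assoc, anticomm_Bp_Bm_mul_Bp, add_mul, mul_assoc,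
        smul_mul_assoc]
      exact N.add_mem (hBp k _ hw) (N.smul_mem _ (hBp i _ (hpara w)))
  have hBm : ∀ i a, Bm i * paraToU n a ∈ N := by
    intro i a
    let N' : Submodule ℂ (ParaAlg n) :=
      N.comap (LinearMap.mulLeft ℂ (Bm i) ∘ₗ (paraToU n).toLinearMap)
    refine mem_of_left_stable adjoin_range_pb N' ?_ ?_ a
    · change Bm i * paraToU n 1 ∈ N
      rw [map_one, mul_one]
      exact hI (hrel _ (IsVacuumRelator.lower i))
    · rintro _ ⟨k, rfl⟩ w hw
      change Bm i * paraToU n (pb k * w) ∈ N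
      have e : Bm i * paraToU n (pb k * w) =
          anticomm (Bp k) (Bm i) * paraToU n w - Bp k * (Bm i * paraToU n w) := by
        rw [map_mul, paraToU_pb, anticomm]
        noncomm_ring
      rw [e]
      exact N.sub_mem (hG k i w) (hBp k _ hw)
  have hu : u ∈ N := by
    refine mem_of_left_stable adjoin_range_gen N ?_ ?_ u
    · rw [← map_one (paraToU n)]
      exact hpara 1
    · rintro _ ⟨⟨ξ, i⟩, rfl⟩ w hw
      rcases Int.units_eq_one_or ξ with rfl | rfl
      · exact hBp i w hw
      · exact hleft _ (hBm i) w hw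
  obtain ⟨y, hy, z, ⟨a, rfl⟩, rfl⟩ := Submodule.mem_sup.1 hu
  refine ⟨a, ?_⟩
  change y + paraToU n a - paraToU n a ∈ _
  rw [add_sub_cancel_right]
  exact hy

theorem map_tableauOp {R S : Type*} [Ring R] [Ring S] (f : R →+* S) (b : Fin n → R)
    (T : Tableau n) : f (tableauOp b T) = tableauOp (fun i => f (b i)) T := by
  rw [tableauOp, tableauOp, map_list_prod, List.map_reverse, List.map_ofFn]
  congr 3
  funext l
  exact map_columnOp f b _

theorem span_tableauOp_pb :
    Submodule.span ℂ (Set.range fun T : Tableau n => tableauOp pb T) = ⊤ :=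
  span_tableauOp_eq_top pb commute_pb adjoin_range_pb

theorem paraToU_tableauOp (T : Tableau n) : paraToU n (tableauOp pb T) = tableauOp Bp T := by
  have h := map_tableauOp (paraToU n).toRingHom pb T
  simp only [AlgHom.toRingHom_eq_coe, RingHom.coe_coe, paraToU_pb] at h
  exact h

/-- Evaluation of an action on a vector kills the vacuum ideal if the vector is a vacuum. -/
theorem apply_eq_zero_of_mem_vacuumIdeal {p : ℕ} {M : Type*} [AddCommGroup M] [Module ℂ M]
    (ρ : UOsp n →ₐ[ℂ] Module.End ℂ M) {m : M} (h1 : ∀ i, ρ (Bm i) m = 0)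
    (h2 : ∀ i j, ρ (anticomm (Bp i) (Bm j)) m = (if i = j then (p : ℂ) else 0) • m)
    {u : UOsp n} (hu : u ∈ vacuumIdeal n p) : ρ u m = 0 := by
  induction hu using Submodule.span_induction with
  | mem x hx =>
    rcases hx with ⟨i, j⟩ | ⟨i⟩ | ⟨i, j⟩
    · rw [map_sub, LinearMap.sub_apply, h2, AlgHom.commutes, Module.algebraMap_end_apply, sub_self]
    · exact h1 i
    · simp [anticomm, h1]
  | zero => simp
  | add x y _ _ hx hy => rw [map_add, LinearMap.add_apply, hx, hy, add_zero]
  | smul a x _ hx => rw [smul_eq_mul, map_mul, Module.End.mul_apply, hx, map_zero]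

/-- Creation operators applied to the vacuum of the induced module. -/
def toInduced (n p : ℕ) : ParaAlg n →ₗ[ℂ] InducedModule n p :=
  (vacuumIdeal n p).mkQ.restrictScalars ℂ ∘ₗ (paraToU n).toLinearMap

theorem toInduced_tableauOp (p : ℕ) (T : Tableau n) : toInduced n p (tableauOp pb T) = v p T := by
  change Submodule.Quotient.mk (paraToU n (tableauOp pb T)) = tableauOp Bp T • vacuum n p
  rw [paraToU_tableauOp, vacuum, ← Submodule.Quotient.mk_smul, smul_eq_mul, mul_one]

theorem toInduced_surjective (p : ℕ) : Function.Surjective (toInduced n p) := by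
  intro x
  obtain ⟨u, rfl⟩ := Submodule.Quotient.mk_surjective _ x
  obtain ⟨a, ha⟩ := exists_sub_mem_vacuumIdeal p u
  exact ⟨a, ((Submodule.Quotient.eq _).2 ha).symm⟩

/-- In the action on `ParaAlg n` the element `a` sends `1` to `a`, whereas the vacuum ideal
annihilates `1`. -/
theorem toInduced_injective (p : ℕ) : Function.Injective (toInduced n p) := by
  obtain ⟨ρ, h1, h2, h3⟩ := exists_action n (p : ℂ)
  rw [← LinearMap.ker_eq_bot, LinearMap.ker_eq_bot']
  intro a ha
  have hmem : paraToU n a ∈ vacuumIdeal n p := (Submodule.Quotient.mk_eq_zero _).1 ha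
  have h4 := apply_eq_zero_of_mem_vacuumIdeal ρ h2 h3 hmem
  have h6 : ∀ w, ρ (paraToU n a) w = a * w := by
    clear ha hmem h4
    have ha : a ∈ Algebra.adjoin ℂ (Set.range pb) := adjoin_range_pb ▸ Algebra.mem_top
    induction ha using Algebra.adjoin_induction with
    | mem x hx =>
      obtain ⟨i, rfl⟩ := hx
      intro w
      rw [paraToU_pb, h1, lmulPb_apply]
    | algebraMap z =>
      intro w
      rw [AlgHom.commutes, AlgHom.commutes, Module.algebraMap_end_apply, Algebra.smul_def]
    | add x y _ _ hx hy =>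
      intro w
      rw [map_add, map_add, LinearMap.add_apply, hx, hy, add_mul]
    | mul x y _ _ hx hy =>
      intro w
      rw [map_mul, map_mul, Module.End.mul_apply, hx, hy, mul_assoc]
  rw [← h4, h6, mul_one]

/-- The tableau vectors span the induced module. -/
theorem span_v (p : ℕ) : Submodule.span ℂ (Set.range fun T : Tableau n => v p T) = ⊤ := by
  have h : (Set.range fun T : Tableau n => v p T) =
      toInduced n p '' Set.range fun T : Tableau n => tableauOp pb T := by
    rw [← Set.range_comp]
    congr 1
    funext T
    exact (toInduced_tableauOp p T).symm
  rw [h, Submodule.span_image, span_tableauOp_pb, Submodule.map_top,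
    LinearMap.range_eq_top.2 (toInduced_surjective p)]

theorem linearIndependent_v (p : ℕ)
    (h : LinearIndependent ℂ fun T : Tableau n => (tableauOp pb T : ParaAlg n)) :
    LinearIndependent ℂ fun T : Tableau n => v p T := by
  have e : (fun T : Tableau n => v p T) =
      toInduced n p ∘ fun T : Tableau n => tableauOp pb T :=
    funext fun T => (toInduced_tableauOp p T).symm
  rw [e]
  exact h.map' (toInduced n p) (LinearMap.ker_eq_bot.2 (toInduced_injective p))

end Induced

/-! ### Leading terms of polynomials with noncommutative coefficients. -/

section LeadingTerms

variable {σ Γ C : Type*} [Ring C] [Algebra ℂ C] [AddCommMonoid Γ]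

/-- Polynomials with coefficients in `C` all of whose monomials have weight in `S`. -/
def weightIn (wt : (σ →₀ ℕ) →+ Γ) (C : Type*) [Ring C] [Algebra ℂ C] (S : Set Γ) :
    Submodule ℂ (MvPolynomial σ ℂ ⊗[ℂ] C) :=
  Submodule.span ℂ {x | ∃ m c, wt m ∈ S ∧ x = MvPolynomial.monomial m 1 ⊗ₜ[ℂ] c}

variable {wt : (σ →₀ ℕ) →+ Γ}

theorem monomial_tmul_mem {S : Set Γ} {m : σ →₀ ℕ} (hm : wt m ∈ S) (c : C) :
    MvPolynomial.monomial m 1 ⊗ₜ[ℂ] c ∈ weightIn wt C S :=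
  Submodule.subset_span ⟨m, c, hm, rfl⟩

theorem mul_mem_weightIn {S T U : Set Γ} (h : ∀ s ∈ S, ∀ t ∈ T, s + t ∈ U)
    {x y : MvPolynomial σ ℂ ⊗[ℂ] C} (hx : x ∈ weightIn wt C S) (hy : y ∈ weightIn wt C T) :
    x * y ∈ weightIn wt C U := by
  have h1 : x * y ∈ weightIn wt C S * weightIn wt C T := Submodule.mul_mem_mul hx hy
  rw [weightIn, weightIn, Submodule.span_mul_span] at h1
  refine Submodule.span_le.2 ?_ h1
  rintro _ ⟨_, ⟨m, c, hm, rfl⟩, _, ⟨m', c', hm', rfl⟩, rfl⟩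
  change MvPolynomial.monomial m 1 ⊗ₜ[ℂ] c * MvPolynomial.monomial m' 1 ⊗ₜ[ℂ] c' ∈ weightIn wt C U
  rw [Algebra.TensorProduct.tmul_mul_tmul, MvPolynomial.monomial_mul, one_mul]
  refine monomial_tmul_mem ?_ _
  rw [map_add]
  exact h _ hm _ hm'

theorem weightIn_mono {S T : Set Γ} (h : S ⊆ T) : weightIn wt C S ≤ weightIn wt C T :=
  Submodule.span_mono fun _ ⟨m, c, hm, hx⟩ => ⟨m, c, h hm, hx⟩

/-- The coefficient of a monomial. -/
def coeffAt (C : Type*) [Ring C] [Algebra ℂ C] (m : σ →₀ ℕ) : MvPolynomial σ ℂ ⊗[ℂ] C →ₗ[ℂ] C :=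
  (TensorProduct.lid ℂ C).toLinearMap ∘ₗ
    TensorProduct.map (MvPolynomial.lcoeff ℂ m) LinearMap.id

theorem coeffAt_monomial_tmul [DecidableEq σ] (m m' : σ →₀ ℕ) (c : C) :
    coeffAt C m (MvPolynomial.monomial m' 1 ⊗ₜ[ℂ] c) = if m' = m then c else 0 := by
  simp [coeffAt, MvPolynomial.coeff_monomial]

theorem coeffAt_eq_zero {S : Set Γ} {m : σ →₀ ℕ} (hm : wt m ∉ S) {x : MvPolynomial σ ℂ ⊗[ℂ] C}
    (hx : x ∈ weightIn wt C S) : coeffAt C m x = 0 := by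
  classical
  refine (Submodule.span_le (p := LinearMap.ker (coeffAt C m))).2 ?_ hx
  rintro _ ⟨m', c, hm', rfl⟩
  rw [SetLike.mem_coe, LinearMap.mem_ker, coeffAt_monomial_tmul, if_neg]
  rintro rfl
  exact hm hm'

variable [PartialOrder Γ]

/-- `c x^m` is the leading term of `a`. -/
def HasLead (wt : (σ →₀ ℕ) →+ Γ) (a : MvPolynomial σ ℂ ⊗[ℂ] C) (m : σ →₀ ℕ) (c : C) : Prop :=
  a - MvPolynomial.monomial m 1 ⊗ₜ[ℂ] c ∈ weightIn wt C (Set.Iio (wt m))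

theorem HasLead.mem_Iic {a : MvPolynomial σ ℂ ⊗[ℂ] C} {m : σ →₀ ℕ} {c : C}
    (h : HasLead wt a m c) : a ∈ weightIn wt C (Set.Iic (wt m)) := by
  rw [← sub_add_cancel a (MvPolynomial.monomial m 1 ⊗ₜ[ℂ] c)]
  exact Submodule.add_mem _ (weightIn_mono Set.Iio_subset_Iic_self h)
    (monomial_tmul_mem Set.self_mem_Iic c)

theorem HasLead.one : HasLead wt (1 : MvPolynomial σ ℂ ⊗[ℂ] C) 0 1 := by
  have h : (1 : MvPolynomial σ ℂ ⊗[ℂ] C) - MvPolynomial.monomial 0 1 ⊗ₜ[ℂ] 1 = 0 :=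
    sub_self _
  rw [HasLead, h]
  exact Submodule.zero_mem _

theorem HasLead.mul [IsOrderedCancelAddMonoid Γ] {a b : MvPolynomial σ ℂ ⊗[ℂ] C}
    {m m' : σ →₀ ℕ} {c c' : C} (h : HasLead wt a m c) (h' : HasLead wt b m' c') :
    HasLead wt (a * b) (m + m') (c * c') := by
  have e : a * b - MvPolynomial.monomial (m + m') 1 ⊗ₜ[ℂ] (c * c') =
      (a - MvPolynomial.monomial m 1 ⊗ₜ[ℂ] c) * b +
        MvPolynomial.monomial m 1 ⊗ₜ[ℂ] c * (b - MvPolynomial.monomial m' 1 ⊗ₜ[ℂ] c') := by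
    rw [sub_mul, mul_sub, Algebra.TensorProduct.tmul_mul_tmul, MvPolynomial.monomial_mul, one_mul]
    abel
  rw [HasLead, e, map_add]
  refine Submodule.add_mem _ (mul_mem_weightIn ?_ h h'.mem_Iic)
    (mul_mem_weightIn ?_ (monomial_tmul_mem Set.self_mem_Iic c) h')
  · exact fun s hs t ht => add_lt_add_of_lt_of_le hs ht
  · exact fun s hs t ht => add_lt_add_of_le_of_lt hs ht

theorem HasLead.list_prod [IsOrderedCancelAddMonoid Γ] {ι : Type*}
    {a : ι → MvPolynomial σ ℂ ⊗[ℂ] C} {m : ι → σ →₀ ℕ} {c : ι → C}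
    (h : ∀ i, HasLead wt (a i) (m i) (c i)) (l : List ι) :
    HasLead wt (l.map a).prod (l.map m).sum (l.map c).prod := by
  induction l with
  | nil => exact HasLead.one
  | cons i l ih =>
    simp only [List.map_cons, List.prod_cons, List.sum_cons]
    exact (h i).mul ih

theorem HasLead.coeffAt_self {a : MvPolynomial σ ℂ ⊗[ℂ] C} {m : σ →₀ ℕ} {c : C}
    (h : HasLead wt a m c) : coeffAt C m a = c := by
  classical
  have h1 := coeffAt_eq_zero (S := Set.Iio (wt m)) (m := m) (lt_irrefl _) h
  rwa [map_sub, coeffAt_monomial_tmul, if_pos rfl, sub_eq_zero] at h1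

theorem HasLead.coeffAt_of_ne {a : MvPolynomial σ ℂ ⊗[ℂ] C} {m m' : σ →₀ ℕ} {c : C}
    (h : HasLead wt a m c) (hne : m ≠ m') (hlt : ¬ wt m' < wt m) : coeffAt C m' a = 0 := by
  classical
  have h1 := coeffAt_eq_zero (S := Set.Iio (wt m)) (m := m') hlt h
  rwa [map_sub, coeffAt_monomial_tmul, if_neg hne, sub_zero] at h1

/-- Elements with distinct leading monomials are linearly independent. -/
theorem linearIndependent_of_hasLead {ι : Type*} {a : ι → MvPolynomial σ ℂ ⊗[ℂ] C}
    {m : ι → σ →₀ ℕ} {c : ι → C} (h : ∀ i, HasLead wt (a i) (m i) (c i))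
    (hm : Function.Injective m) (hc : ∀ i, c i ≠ 0) : LinearIndependent ℂ a := by
  rw [linearIndependent_iff]
  intro f hf
  by_contra hne
  -- At a leading monomial of maximal weight, no other member of the combination has a nonzero
  -- coefficient.
  obtain ⟨i, hi, hmax⟩ := f.support.exists_maximalFor (fun i => wt (m i))
    (Finsupp.support_nonempty_iff.2 hne)
  have h1 := congrArg (coeffAt C (m i)) hf
  rw [Finsupp.linearCombination_apply, Finsupp.sum, map_sum, Finset.sum_eq_single i, map_smul,
    (h i).coeffAt_self, map_zero] at h1
  · exact (smul_eq_zero.1 h1).elim (Finsupp.mem_support_iff.1 hi) (hc i)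
  · intro j hj hji
    rw [map_smul, (h j).coeffAt_of_ne (hm.ne hji), smul_zero]
    exact fun hlt => hlt.not_ge (hmax hj hlt.le)
  · exact fun hni => absurd hi hni

end LeadingTerms

/-! ### Antisymmetrized products of Clifford generators. -/

section Clifford

theorem e_mul_self {p : ℕ} (α : Fin p) : e α * e α = 1 := by
  have h := e_anticomm α α
  rw [if_pos rfl, ← two_smul ℂ, Algebra.algebraMap_eq_smul_one] at h
  exact smul_right_injective (Cl p) (two_ne_zero' ℂ) h

theorem e_swap {p : ℕ} {α β : Fin p} (h : α ≠ β) : e β * e α = -(e α * e β) := by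
  have h' := e_anticomm α β
  rw [if_neg h, map_zero] at h'
  exact (neg_eq_of_add_eq_zero_right h').symm

theorem isUnit_e {p : ℕ} (α : Fin p) : IsUnit (e α) :=
  ⟨⟨e α, e α, e_mul_self α, e_mul_self α⟩, rfl⟩

/-- Distinct `e_α` anticommute, so the elements `e_{w r} ⊗ η_r` commute and their product does not
depend on the order. The sign is then read off from the Grassmann factor. -/
theorem list_prod_e_comp_perm {p k : ℕ} {w : Fin k → Fin p} (hw : Function.Injective w)
    (σ : Equiv.Perm (Fin k)) :
    (List.ofFn fun r => e (w (σ r))).prod =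
      ((Equiv.Perm.sign σ : ℤˣ) : ℤ) • (List.ofFn fun r => e (w r)).prod := by
  let g : Fin k → Cl p ⊗[ℂ] ExteriorAlgebra ℂ (Fin k → ℂ) := fun r => e (w r) ⊗ₜ grassmannGen r
  have hg : ∀ r s, Commute (g r) (g s) := by
    intro r s
    rcases eq_or_ne r s with rfl | h
    · exact Commute.refl _
    · change g r * g s = g s * g r
      simp only [g]
      rw [Algebra.TensorProduct.tmul_mul_tmul, Algebra.TensorProduct.tmul_mul_tmul,
        e_swap (hw.ne h), grassmannGen_swap r s, TensorProduct.neg_tmul, TensorProduct.tmul_neg,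
        neg_neg]
  have h1 : (List.ofFn fun r => g (σ r)).prod = (List.ofFn g).prod := by
    refine (Equiv.Perm.ofFn_comp_perm σ g).prod_eq' (List.pairwise_iff_getElem.2 ?_)
    intro i j hi hj _
    rw [List.getElem_ofFn, List.getElem_ofFn]
    exact hg _ _
  simp only [g] at h1
  rw [list_prod_ofFn_tmul, list_prod_ofFn_tmul] at h1
  change _ ⊗ₜ grassmannProd (fun r => id (σ r)) = _ ⊗ₜ grassmannProd id at h1
  rw [grassmannProd_comp_perm] at h1
  obtain ⟨f, hf⟩ := Module.Projective.exists_dual_ne_zero ℂ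
    (grassmannProd_ne_zero (w := (id : Fin k → Fin k)) Function.injective_id)
  have h2 := congrArg (TensorProduct.rid ℂ (Cl p) ∘ TensorProduct.map LinearMap.id f) h1
  simp only [Function.comp_apply, TensorProduct.map_tmul, TensorProduct.rid_tmul,
    LinearMap.id_apply, map_zsmul] at h2
  rw [smul_assoc, smul_comm] at h2
  rw [← smul_right_injective (Cl p) hf h2, smul_smul, Int.units_coe_mul_self, one_smul]

theorem columnOp_e {p k : ℕ} {w : Fin k → Fin p} (hw : Function.Injective w) :
    columnOp e w = k.factorial • (List.ofFn fun r => e (w r)).prod := by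
  rw [columnOp]
  have h : ∀ σ : Equiv.Perm (Fin k), ((Equiv.Perm.sign σ : ℤˣ) : ℤ) •
      (List.ofFn fun r => e (w (σ r))).prod = (List.ofFn fun r => e (w r)).prod := by
    intro σ
    rw [list_prod_e_comp_perm hw, smul_smul, Int.units_coe_mul_self, one_smul]
  simp only [h]
  simp [Fintype.card_perm]

theorem isUnit_columnOp_e {p k : ℕ} {w : Fin k → Fin p} (hw : Function.Injective w) :
    IsUnit (columnOp e w) := by
  rw [columnOp_e hw, nsmul_eq_mul, ← map_natCast (algebraMap ℂ (Cl p))]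
  refine IsUnit.mul (IsUnit.map _ (Nat.cast_ne_zero.2 k.factorial_ne_zero).isUnit) ?_
  refine List.prod_isUnit fun x hx => ?_
  obtain ⟨r, rfl⟩ := List.mem_ofFn.1 hx
  exact isUnit_e _

instance (p : ℕ) : Nontrivial (Cl p) := by
  have : Invertible (2 : ℂ) := invertibleOfNonzero two_ne_zero
  infer_instance

end Clifford

/-! ### Leading terms of column operators on Clifford algebra valued polynomials. -/

section Fock

variable {n p : ℕ}

/-- The Clifford algebra valued polynomial `∑_α x_{i,α} e_α`. -/
def fockVar (p : ℕ) (i : Fin n) : CliffPoly n p :=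
  ∑ α : Fin p, MvPolynomial.X (i, α) ⊗ₜ[ℂ] e α

theorem X_eq_lmul (i : Fin n) : X p i = Algebra.lmul ℂ (CliffPoly n p) (fockVar p i) := by
  apply TensorProduct.ext'
  intro f c
  simp [X, fockVar]

theorem tableauOp_lmul_apply {R : Type*} [Ring R] [Algebra ℂ R] (b : Fin n → R) (A : Tableau n)
    (x : R) : tableauOp (fun i => Algebra.lmul ℂ R (b i)) A x = tableauOp b A * x := by
  have h := map_tableauOp (Algebra.lmul ℂ R).toRingHom b A
  exact (LinearMap.congr_fun h x).symm

theorem ω_eq_tableauOp (A : Tableau n) : ω p A = tableauOp (fockVar p) A := by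
  have h := tableauOp_lmul_apply (R := CliffPoly n p) (fockVar p) A 1
  rw [mul_one] at h
  rw [← h, ω, funext X_eq_lmul]

/-- The monomial `∏_r x_{I r, w r}`. -/
def expo {k : ℕ} (I : Fin k → Fin n) (w : Fin k → Fin p) : Fin n × Fin p →₀ ℕ :=
  ∑ r, Finsupp.single (I r, w r) 1

theorem columnOp_fockVar {k : ℕ} (I : Fin k → Fin n) :
    columnOp (fockVar p) I =
      ∑ w : Fin k → Fin p, MvPolynomial.monomial (expo I w) 1 ⊗ₜ[ℂ] columnOp e w := by
  have h1 : ∀ σ : Equiv.Perm (Fin k), (List.ofFn fun r => fockVar p (I (σ r))).prod =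
      ∑ w : Fin k → Fin p, MvPolynomial.monomial (expo I w) 1 ⊗ₜ[ℂ]
        (List.ofFn fun r => e (w (σ r))).prod := by
    intro σ
    simp only [fockVar]
    rw [list_prod_ofFn_sum (R := CliffPoly n p)
      (fun r α => MvPolynomial.X (I (σ r), α) ⊗ₜ[ℂ] e α)]
    refine (Fintype.sum_equiv (Equiv.arrowCongr σ (Equiv.refl (Fin p))) _ _ fun w => ?_)
    have h2 : ∀ r, Equiv.arrowCongr σ (Equiv.refl (Fin p)) w (σ r) = w r := fun r => by simp
    simp only [h2]
    rw [list_prod_ofFn_tmul, List.prod_ofFn, expo, MvPolynomial.monomial_sum_one]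
    congr 1
    rw [← Equiv.prod_comp σ (fun r => MvPolynomial.monomial (Finsupp.single (I r, _) 1) 1)]
    refine Finset.prod_congr rfl fun r _ => ?_
    rw [h2]
    rfl
  rw [columnOp]
  simp only [h1, Finset.smul_sum]
  rw [Finset.sum_comm]
  refine Finset.sum_congr rfl fun w _ => ?_
  rw [columnOp, TensorProduct.tmul_sum]
  simp only [TensorProduct.tmul_smul]

/-- Every `w : Fin k → Fin p` repeats a value, and the antisymmetrized Clifford product then
vanishes. -/
theorem columnOp_fockVar_eq_zero {k : ℕ} (I : Fin k → Fin n) (hk : p < k) :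
    columnOp (fockVar p) I = 0 := by
  rw [columnOp_fockVar]
  refine Finset.sum_eq_zero fun w _ => ?_
  rw [columnOp_eq_zero e fun hw => ?_, TensorProduct.tmul_zero]
  have := Fintype.card_le_of_injective w hw
  simp at this
  omega

/-- Exponents, compared lexicographically. -/
def lexWeight (n p : ℕ) : (Fin n × Fin p →₀ ℕ) →+ Lex (Fin n ×ₗ Fin p → ℕ) where
  toFun m := toLex fun j => m (ofLex j)
  map_zero' := rfl
  map_add' _ _ := rfl

/-- Let `r₀` be the first place where `w` departs from the inclusion. The values below `r₀` are
already taken, so injectivity forces `w r₀ > r₀`. The exponent of `x_{I r₀, r₀}` thus drops from `1`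
to `0`, while the exponents of all preceding variables agree because `I` is increasing. -/
theorem lexWeight_lt {k : ℕ} {I : Fin k → Fin n} (hI : StrictMono I) (hk : k ≤ p)
    {w : Fin k → Fin p} (hw : Function.Injective w) (hne : w ≠ Fin.castLE hk) :
    lexWeight n p (expo I w) < lexWeight n p (expo I (Fin.castLE hk)) := by
  classical
  have hex : ∃ r, w r ≠ Fin.castLE hk r := by
    by_contra! h
    exact hne (funext h)
  obtain ⟨r₀, h₀, hmin⟩ : ∃ r₀, w r₀ ≠ Fin.castLE hk r₀ ∧ ∀ r < r₀, w r = Fin.castLE hk r := by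
    obtain ⟨r, hr, hmin⟩ := WellFounded.has_min (wellFounded_lt (α := Fin k))
      {r | w r ≠ Fin.castLE hk r} hex
    exact ⟨r, hr, fun s hs => by_contra fun h => hmin s h hs⟩
  have hlt : Fin.castLE hk r₀ < w r₀ := by
    refine lt_of_le_of_ne ?_ h₀.symm
    by_contra! h
    have h1 : (w r₀ : ℕ) < r₀ := h
    have h2 := hmin ⟨w r₀, h1.trans r₀.2⟩ h1
    have h3 : w ⟨w r₀, h1.trans r₀.2⟩ = w r₀ := h2.trans (Fin.ext rfl)
    exact h1.ne (congrArg Fin.val (hw h3))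
  have happ : ∀ (w' : Fin k → Fin p) (a : Fin n × Fin p),
      lexWeight n p (expo I w') (toLex a) = ∑ r, if (I r, w' r) = a then 1 else 0 := by
    intro w' a
    change expo I w' a = _
    rw [expo, Finsupp.finsetSum_apply]
    exact Finset.sum_congr rfl fun r _ => Finsupp.single_apply
  refine ⟨toLex (I r₀, Fin.castLE hk r₀), toLex.surjective.forall.2 fun a hj => ?_, ?_⟩
  · rw [happ, happ]
    refine Finset.sum_congr rfl fun r _ => ?_
    rcases lt_trichotomy r r₀ with h | rfl | h
    · rw [hmin r h]
    · rw [if_neg, if_neg]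
      · rintro h
        exact hj.ne (congrArg toLex h).symm
      · rintro h
        rw [← h, Prod.Lex.toLex_lt_toLex] at hj
        rcases hj with hj | hj
        · exact lt_irrefl _ hj
        · exact hlt.not_gt hj.2
    · have h' : ∀ w' : Fin k → Fin p, (I r, w' r) ≠ a := by
        intro w' h2
        rw [← h2, Prod.Lex.toLex_lt_toLex] at hj
        rcases hj with hj | hj
        · exact hj.not_gt (hI h)
        · exact (hI h).ne hj.1.symm
      rw [if_neg (h' _), if_neg (h' _)]
  · rw [happ, happ]
    refine Finset.sum_lt_sum (fun r _ => ?_) ⟨r₀, Finset.mem_univ _, ?_⟩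
    · by_cases h : (I r, w r) = (I r₀, Fin.castLE hk r₀)
      · have h1 : r = r₀ := hI.injective (congrArg Prod.fst h)
        subst h1
        exact absurd (congrArg Prod.snd h) h₀
      · rw [if_neg h]
        exact Nat.zero_le _
    · rw [if_neg, if_pos rfl]
      · exact Nat.zero_lt_one
      · exact fun h => h₀ (congrArg Prod.snd h)

theorem hasLead_columnOp {k : ℕ} {I : Fin k → Fin n} (hI : StrictMono I) (hk : k ≤ p) :
    HasLead (lexWeight n p) (columnOp (fockVar p) I) (expo I (Fin.castLE hk))
      (columnOp e (Fin.castLE hk)) := by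
  classical
  rw [HasLead, columnOp_fockVar, ← Finset.sum_erase_eq_sub (Finset.mem_univ _)]
  refine Submodule.sum_mem _ fun w hw => ?_
  by_cases hw' : Function.Injective w
  · exact monomial_tmul_mem (lexWeight_lt hI hk hw' (Finset.ne_of_mem_erase hw)) _
  · rw [columnOp_eq_zero e hw', TensorProduct.tmul_zero]
    exact Submodule.zero_mem _

end Fock

/-! ### Leading monomials of the tableau vectors and their independence. -/

section TableauVectors

variable {n p : ℕ}

namespace Tableau

variable (A : Tableau n)

theorem colLen_le_numRows (l : ℕ) : A.shape.colLen l ≤ A.numRows :=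
  A.shape.colLen_anti 0 l (Nat.zero_le l)

theorem col_strictMono (l : ℕ) : StrictMono (A.col l) := fun _ s h =>
  A.filling.col_strict h (YoungDiagram.mem_iff_lt_colLen.2 s.2)

theorem numRows_le : A.numRows ≤ n := by
  have h := Fintype.card_le_of_injective _ (A.col_strictMono 0).injective
  rwa [Fintype.card_fin, Fintype.card_fin] at h

/-- The exponents of the leading monomial of a tableau vector. -/
def lead (hA : A.numRows ≤ p) : Fin n × Fin p →₀ ℕ :=
  ((List.finRange A.numCols).reverse.map fun l : Fin A.numCols =>
    expo (A.col l) (Fin.castLE ((A.colLen_le_numRows l).trans hA))).sum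

/-- The number of entries less than `t` in the row `r`. -/
def rowCount (r t : ℕ) : Finset ℕ :=
  (Finset.range (A.shape.rowLen r)).filter fun l => A.filling r l < t

theorem mem_rowCount {r t l : ℕ} : l ∈ A.rowCount r t ↔ (r, l) ∈ A.shape ∧ A.filling r l < t := by
  rw [rowCount, Finset.mem_filter, Finset.mem_range, YoungDiagram.mem_iff_lt_rowLen]

/-- Rows increase weakly, so the positions of the entries less than `t` form an initial segment,
which is determined by its size. -/
theorem lt_card_rowCount {r t l : ℕ} :
    l < (A.rowCount r t).card ↔ (r, l) ∈ A.shape ∧ A.filling r l < t := by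
  rw [← mem_rowCount]
  have hdown : ∀ {a b : ℕ}, a ≤ b → b ∈ A.rowCount r t → a ∈ A.rowCount r t := by
    intro a b hab hb
    rw [mem_rowCount] at hb ⊢
    exact ⟨A.shape.up_left_mem le_rfl hab hb.1, (A.filling.row_weak_of_le hab hb.1).trans_lt hb.2⟩
  constructor
  · intro h
    by_contra hl
    have h1 : A.rowCount r t ⊆ Finset.range l := fun b hb =>
      Finset.mem_range.2 (not_le.1 fun hle => hl (hdown hle hb))
    have h2 := Finset.card_le_card h1
    rw [Finset.card_range] at h2
    omega
  · intro h
    have h1 : Finset.range (l + 1) ⊆ A.rowCount r t := fun b hb =>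
      hdown (Nat.lt_succ_iff.1 (Finset.mem_range.1 hb)) h
    have h2 := Finset.card_le_card h1
    rw [Finset.card_range] at h2
    omega

theorem ext_of_card_rowCount {A A' : Tableau n}
    (h : ∀ r t, (A.rowCount r t).card = (A'.rowCount r t).card) : A = A' := by
  have h1 : ∀ r t l, ((r, l) ∈ A.shape ∧ A.filling r l < t) ↔
      ((r, l) ∈ A'.shape ∧ A'.filling r l < t) := by
    intro r t l
    rw [← lt_card_rowCount, ← lt_card_rowCount, h]
  obtain ⟨μ, T, hT⟩ := A
  obtain ⟨μ', T', hT'⟩ := A'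
  have hμ : μ = μ' := by
    ext ⟨r, l⟩
    -- Taking `t = n` detects the cells, since all entries are less than `n`.
    exact ⟨fun hm => ((h1 r _ l).1 ⟨hm, hT hm⟩).1, fun hm => ((h1 r _ l).2 ⟨hm, hT' hm⟩).1⟩
  subst hμ
  have hT : T = T' := by
    ext r l
    by_cases hm : (r, l) ∈ μ
    · have h2 : ∀ t, T r l < t ↔ T' r l < t := fun t =>
        ⟨fun hlt => ((h1 r t l).1 ⟨hm, hlt⟩).2, fun hlt => ((h1 r t l).2 ⟨hm, hlt⟩).2⟩
      exact le_antisymm (Nat.lt_succ_iff.1 ((h2 _).2 (Nat.lt_succ_self _)))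
        (Nat.lt_succ_iff.1 ((h2 _).1 (Nat.lt_succ_self _)))
    · rw [T.zeros hm, T'.zeros hm]
  subst hT
  rfl

theorem card_rowCount_eq_zero {r : ℕ} (hr : A.numRows ≤ r) (t : ℕ) : (A.rowCount r t).card = 0 := by
  rw [Finset.card_eq_zero, Finset.eq_empty_iff_forall_notMem]
  intro l hl
  have h1 := YoungDiagram.mem_iff_lt_colLen.1 ((A.mem_rowCount).1 hl).1
  have h2 := A.colLen_le_numRows l
  omega

theorem expo_col_apply (hA : A.numRows ≤ p) (l : ℕ) (i : Fin n) (r : Fin p) :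
    expo (A.col l) (Fin.castLE ((A.colLen_le_numRows l).trans hA)) (i, r) =
      if ((r : ℕ), l) ∈ A.shape ∧ A.filling r l = i then 1 else 0 := by
  classical
  rw [expo, Finsupp.finsetSum_apply]
  simp only [Finsupp.single_apply]
  split_ifs with h
  · have hr := YoungDiagram.mem_iff_lt_colLen.1 h.1
    rw [Finset.sum_eq_single ⟨r, hr⟩, if_pos]
    · exact Prod.ext (Fin.ext h.2) (Fin.ext rfl)
    · intro s _ hs
      rw [if_neg]
      intro h'
      exact hs (Fin.ext (congrArg (fun x => (x.2 : ℕ)) h'))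
    · exact fun h' => absurd (Finset.mem_univ _) h'
  · refine Finset.sum_eq_zero fun s _ => if_neg fun h' => h ?_
    have h1 : (s : ℕ) = r := congrArg (fun x => (x.2 : ℕ)) h'
    have h2 : A.filling s l = i := congrArg (fun x => (x.1 : ℕ)) h'
    rw [← h1]
    exact ⟨YoungDiagram.mem_iff_lt_colLen.2 s.2, h2⟩

/-- The exponent of `x_{i, r}` in the leading monomial is the number of entries `i` in row `r`, as
each column contributes `x_{i, r}` for its entry `i` in row `r`. -/
theorem card_rowCount (hA : A.numRows ≤ p) (r : Fin p) (t : ℕ) :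
    (A.rowCount r t).card = ∑ i : Fin n, if (i : ℕ) < t then A.lead hA (i, r) else 0 := by
  classical
  have h1 : ∀ i : Fin n, A.lead hA (i, r) =
      ∑ l : Fin A.numCols, if ((r : ℕ), (l : ℕ)) ∈ A.shape ∧ A.filling r l = i then 1 else 0 := by
    intro i
    rw [lead, List.Perm.sum_eq ((List.reverse_perm _).map _), ← List.ofFn_eq_map, List.sum_ofFn,
      Finsupp.finsetSum_apply]
    exact Finset.sum_congr rfl fun l _ => A.expo_col_apply hA l i r
  have h2 : ∀ i : Fin n, (if (i : ℕ) < t then A.lead hA (i, r) else 0) =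
      ∑ l : Fin A.numCols,
        if ((r : ℕ), (l : ℕ)) ∈ A.shape ∧ A.filling r l = i ∧ (i : ℕ) < t then 1 else 0 := by
    intro i
    rw [h1]
    split_ifs with h <;> simp [h]
  simp only [h2]
  rw [Finset.sum_comm]
  have h3 : ∀ l : ℕ, (∑ i : Fin n,
      if ((r : ℕ), l) ∈ A.shape ∧ A.filling r l = i ∧ (i : ℕ) < t then 1 else 0) =
        if l ∈ A.rowCount r t then 1 else 0 := by
    intro l
    simp only [mem_rowCount]
    split_ifs with h
    · rw [Finset.sum_eq_single ⟨A.filling r l, A.entry_lt h.1⟩, if_pos ⟨h.1, rfl, h.2⟩]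
      · exact fun i _ hi => if_neg fun h' => hi (Fin.ext h'.2.1.symm)
      · exact fun h' => absurd (Finset.mem_univ _) h'
    · refine Finset.sum_eq_zero fun i _ => if_neg ?_
      rintro ⟨h1, h2, h3⟩
      exact h ⟨h1, h2.trans_lt h3⟩
  simp only [h3]
  rw [Fin.sum_univ_eq_sum_range (fun l => if l ∈ A.rowCount r t then 1 else 0),
    ← Finset.card_filter, Finset.filter_mem_eq_inter, Finset.inter_eq_right.2]
  intro l hl
  rw [Finset.mem_range]
  exact (YoungDiagram.mem_iff_lt_rowLen.1 (A.mem_rowCount.1 hl).1).trans_le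
    (A.shape.rowLen_anti 0 r (Nat.zero_le r))

theorem lead_injective {A A' : Tableau n} (hA : A.numRows ≤ p) (hA' : A'.numRows ≤ p)
    (h : A.lead hA = A'.lead hA') : A = A' := by
  refine ext_of_card_rowCount fun r t => ?_
  rcases lt_or_ge r p with hr | hr
  · have h1 := A.card_rowCount hA ⟨r, hr⟩ t
    have h2 := A'.card_rowCount hA' ⟨r, hr⟩ t
    rw [h] at h1
    exact h1.trans h2.symm
  · rw [A.card_rowCount_eq_zero (hA.trans hr), A'.card_rowCount_eq_zero (hA'.trans hr)]

end Tableau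

theorem ω_eq_zero {A : Tableau n} (hA : p < A.numRows) : ω p A = 0 := by
  rw [ω_eq_tableauOp, tableauOp]
  have h0 : 0 < A.numCols := by
    have h : (0, 0) ∈ A.shape := YoungDiagram.mem_iff_lt_colLen.2 (Nat.zero_lt_of_lt hA)
    exact YoungDiagram.mem_iff_lt_rowLen.1 h
  refine List.prod_eq_zero ?_
  rw [List.mem_reverse, List.mem_ofFn]
  exact ⟨⟨0, h0⟩, columnOp_fockVar_eq_zero _ hA⟩

theorem hasLead_ω {A : Tableau n} (hA : A.numRows ≤ p) :
    ∃ c, IsUnit c ∧ HasLead (lexWeight n p) (ω p A) (A.lead hA) c := by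
  refine ⟨((List.finRange A.numCols).reverse.map fun l : Fin A.numCols =>
    columnOp e (Fin.castLE ((A.colLen_le_numRows l).trans hA))).prod, ?_, ?_⟩
  rotate_left
  · rw [ω_eq_tableauOp, tableauOp, List.ofFn_eq_map, ← List.map_reverse]
    exact HasLead.list_prod (fun l : Fin A.numCols =>
      hasLead_columnOp (A.col_strictMono l) ((A.colLen_le_numRows l).trans hA)) _
  · refine List.prod_isUnit fun x hx => ?_
    obtain ⟨l, -, rfl⟩ := List.mem_map.1 hx
    exact isUnit_columnOp_e (Fin.castLE_injective _)

/-- The vectors of tableaux with at most `p` rows are linearly independent. -/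
theorem linearIndependent_ω (n p : ℕ) :
    LinearIndependent ℂ fun A : {A : Tableau n // A.numRows ≤ p} => ω p A.1 := by
  choose c hc h using fun A : {A : Tableau n // A.numRows ≤ p} => hasLead_ω A.2
  exact linearIndependent_of_hasLead h
    (fun A A' hAA' => Subtype.ext (Tableau.lead_injective A.2 A'.2 hAA')) fun A => (hc A).ne_zero

end TableauVectors

/-! ### The Fock space as an image of `ParaAlg n`, and independence in `ParaAlg n`. -/

section FockSpace

variable {n : ℕ}

theorem fockRep_paraToU_tableauOp (p : ℕ) (A : Tableau n) :
    fockRep n p (paraToU n (tableauOp pb A)) 1 = ω p A := by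
  have h := map_tableauOp (S := Module.End ℂ (CliffPoly n p)) (fockRep n p).toRingHom Bp A
  rw [paraToU_tableauOp]
  simp only [AlgHom.toRingHom_eq_coe, RingHom.coe_coe, fockRep_Bp] at h
  rw [h]
  rfl

/-- The action of the creation operators on `1`. -/
def toFock (n p : ℕ) : ParaAlg n →ₗ[ℂ] CliffPoly n p :=
  LinearMap.applyₗ (1 : CliffPoly n p) ∘ₗ (fockRep n p).toLinearMap ∘ₗ (paraToU n).toLinearMap

theorem toFock_tableauOp (p : ℕ) (A : Tableau n) : toFock n p (tableauOp pb A) = ω p A :=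
  fockRep_paraToU_tableauOp p A

/-- Columns are strictly increasing, so no tableau has more than `n` rows. With `p = n`,
independence in `𝒜` covers all tableaux and lifts back along `toFock n n`. -/
theorem linearIndependent_tableauOp_pb :
    LinearIndependent ℂ fun A : Tableau n => (tableauOp pb A : ParaAlg n) := by
  refine LinearIndependent.of_comp (toFock n n) ?_
  have h := (linearIndependent_ω n n).comp (fun A : Tableau n => ⟨A, A.numRows_le⟩)
    fun A A' h => congrArg Subtype.val h
  have e : (toFock n n ∘ fun A : Tableau n => (tableauOp pb A : ParaAlg n)) =
      fun A : Tableau n => ω n A := funext fun A => toFock_tableauOp n A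
  rw [e]
  exact h

theorem D_one (p : ℕ) (i : Fin n) : D p i 1 = 0 := by
  rw [Algebra.TensorProduct.one_def]
  simp [D]

theorem D_X_one (p : ℕ) (i j : Fin n) : D p j (X p i 1) = (if i = j then (p : ℂ) else 0) • 1 := by
  rw [Algebra.TensorProduct.one_def]
  simp only [D, X, LinearMap.sum_apply, TensorProduct.map_tmul, map_sum]
  rcases eq_or_ne i j with rfl | h
  · have h1 : ∀ α β : Fin p, (if α = β then (1 : MvPolynomial (Fin n × Fin p) ℂ) else 0) ⊗ₜ[ℂ]
        (e β * e α) = if α = β then 1 ⊗ₜ[ℂ] 1 else 0 := by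
      intro α β
      split_ifs with h
      · rw [h, e_mul_self]
      · rw [TensorProduct.zero_tmul]
    simp [MvPolynomial.pderiv_X, Pi.single_apply, h1, Nat.cast_smul_eq_nsmul]
  · simp [MvPolynomial.pderiv_X, h]

/-- The constant `1` satisfies the vacuum conditions, so the vacuum ideal acts on it by zero and
only creation operators matter. -/
theorem fockRep_mem_range_toFock (p : ℕ) (u : UOsp n) :
    ∃ a, fockRep n p u 1 = toFock n p a := by
  obtain ⟨a, ha⟩ := exists_sub_mem_vacuumIdeal p u
  refine ⟨a, ?_⟩
  have h1 : fockRep n p (u - paraToU n a) 1 = 0 := by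
    refine apply_eq_zero_of_mem_vacuumIdeal (fockRep n p) (fun i => ?_) (fun i j => ?_) ha
    · rw [fockRep_Bm, D_one]
    · rw [anticomm, map_add, map_mul, map_mul, fockRep_Bm, fockRep_Bp, LinearMap.add_apply,
        Module.End.mul_apply, Module.End.mul_apply, D_one, map_zero, zero_add, D_X_one]
  rw [map_sub, LinearMap.sub_apply, sub_eq_zero] at h1
  exact h1

theorem fockSpace_eq_span (n p : ℕ) : fockSpace n p =
    Submodule.span ℂ (Set.range fun A : {A : Tableau n // A.numRows ≤ p} => ω p A.1) := by
  apply le_antisymm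
  · rintro _ ⟨u, rfl⟩
    obtain ⟨a, ha⟩ := fockRep_mem_range_toFock p u
    change fockRep n p u 1 ∈ _
    rw [ha]
    have h1 : Submodule.span ℂ (Set.range fun A : Tableau n => (tableauOp pb A : ParaAlg n)) ≤
        (Submodule.span ℂ (Set.range fun A : {A : Tableau n // A.numRows ≤ p} => ω p A.1)).comap
          (toFock n p) := by
      rw [Submodule.span_le]
      rintro _ ⟨A, rfl⟩
      rw [SetLike.mem_coe, Submodule.mem_comap, toFock_tableauOp]
      rcases le_or_gt A.numRows p with hA | hA
      · exact Submodule.subset_span ⟨⟨A, hA⟩, rfl⟩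
      · rw [ω_eq_zero hA]
        exact Submodule.zero_mem _
    rw [span_tableauOp_pb] at h1
    exact h1 Submodule.mem_top
  · rw [Submodule.span_le]
    rintro _ ⟨A, rfl⟩
    exact ⟨paraToU n (tableauOp pb A.1), toFock_tableauOp p A.1⟩

end FockSpace

end Paraboson

end

theorem theorem5p5 (n p : ℕ) (hn : 0 < n) (hp : 0 < p) :
    (∃ b : Module.Basis (Paraboson.Tableau n) ℂ (Paraboson.InducedModule n p),
      ∀ A : Paraboson.Tableau n, b A = Paraboson.v p A) ∧
    (∃ b : Module.Basis {A : Paraboson.Tableau n // A.numRows ≤ p} ℂ (Paraboson.fockSpace n p),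
      ∀ A : {A : Paraboson.Tableau n // A.numRows ≤ p},
        (b A : Paraboson.CliffPoly n p) = Paraboson.ω p A.1) := by
  constructor
  · refine ⟨Module.Basis.mk
      (Paraboson.linearIndependent_v p Paraboson.linearIndependent_tableauOp_pb)
      (Paraboson.span_v p).ge, fun A => ?_⟩
    rw [Module.Basis.mk_apply]
  · refine ⟨(Module.Basis.span (Paraboson.linearIndependent_ω n p)).map
      (LinearEquiv.ofEq _ _ (Paraboson.fockSpace_eq_span n p).symm), fun A => ?_⟩
    rw [Module.Basis.map_apply, LinearEquiv.coe_ofEq_apply, Module.Basis.span_apply]
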